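/- **Theorem.** Let $n\ge 0$. Permutations are written as words $x_1x_2\cdots x_n$ on $[n]=\{1,\dots,n\}$, and we put $x_0=x_{n+1}=+\infty$ for every word of length $n$. Let $S_n$ be the symmetric group and $\mathcal D_n\subseteq S_n$ the set of derangements; $\operatorname{des}$ denotes the number of descents, i.e. of $1\le i\le n-1$ with $x_i>x_{i+1}$. *Shuffles.* For a word $v$ with positive letters, $\mathrm{Sh}(0^kv)$ is the set of shuffles of $0^k$ and $v$, and $\mathcal S_n^{\mathrm{Der}}=\bigcup_{0\le m\le n,\ v\in\mathcal D_m}\mathrm{Sh}(0^{n-m}v)$. For $\tau\in S_n$ the word $\mathrm{Der}(\tau)$ is obtained by deleting the fixed points of $\tau$ and replacing each remaining letter by its rank among the remaining letters; $\mathrm{ZDer}(\tau)$ is obtained by replacing each fixed point by $0$ and each other letter by its rank among the non-fixed letters. *The map $\Psi$.* For a permutation $\sigma=x_1\cdots x_n$ and $0\le i\le n$, the pair $(i,i+1)$ is the $j$-th slot of $\sigma$ if $x_i\ne i$ and $\sigma$ has exactly $i-j$ fixed points smaller than $i$. Then $\langle\sigma,j\rangle=x_1'\cdots x_i'\,(i+1)\,x_{i+1}'\cdots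 x_n'$, where $x'=x$ for $x\le i$ and $x'=x+1$ for $x>i$, and $\langle\sigma,i_1,\dots,i_m\rangle=\langle\langle\sigma,i_1,\dots,i_{m-1}\rangle,i_m\rangle$. Every $\tau$ in $S_n$ equals $\langle\sigma,i_1,\dots,i_m\rangle$, where $\sigma=\mathrm{Der}(\tau)$ and the fixed points of $\tau$ are $i_1+1<i_2+2<\dots<i_m+m$ (so that $i_1\le\dots\le i_m$). For a derangement $\sigma$ of order $p$, the $j$-th slot ($0\le j\le p$) is green if $\operatorname{des}\langle\sigma,j\rangle=\operatorname{des}\sigma$ and red if $\operatorname{des}\langle\sigma,j\rangle=\operatorname{des}\sigma+1$; the green slots receive the values $0,1,\dots,g$ from right to left, the red ones the values $g+1,\dots,p$ from left to right, and $g_j$ is the value of the $j$-th slot. Put $\Psi(\sigma)=\sigma$ (the case $m=0$), and for $\tau=\langle\sigma,i_1,\dots,i_m\rangle$ with $m\ge1$ define $\Psi(\tau)$ recursively: - if the $i_m$-th slot is green and $\Psi\langle\sigma,i_1,\dots,i_{m-1}\rangle=\langle\sigma,j_2,\dots,j_m\rangle$, then $\Psi(\tau)=\langle\sigma,g_{i_m},j_2,\dots,j_m\rangle$;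 - if it is red, exactly the last $k$ of the $i$'s are equal to $i_m$, and $\Psi\langle\sigma,i_1,\dots,i_{m-k}\rangle=\langle\sigma,j_1,\dots,j_{m-k}\rangle$ (no $j$'s if $k=m$), then $\Psi(\tau)=\langle\sigma,(g_{i_m}-i_m)^{[k-1]},j_1+1,\dots,j_{m-k}+1,g_{i_m}\rangle$, where $t^{[k-1]}$ means $k-1$ terms equal to $t$. *The map $\mathbf\Phi$.* Let $w=x_1\cdots x_n\in\mathcal S_n^{\mathrm{Der}}$ and let $\mathrm{rank}(k)$ be the number of positive letters among $x_1,\dots,x_k$. A positive letter $x_k$ is subexcedent if $x_k<\mathrm{rank}(k)$; all other letters (and $x_0,x_{n+1}$) are non-subexcedent. For $l\ge1$ let $\phi_l(w)=w$ if $w$ has fewer than $l$ zeros; otherwise let $x_j$ be the $l$-th zero from the left. - If $x_{j+1}$ is subexcedent and either $x_{j-1}$ is non-subexcedent, or $x_{j-1}$ is subexcedent with $x_{j-1}>x_{j+1}$, then take the greatest $k\ge j+1$ with $x_{j+1}<\dots<x_k<\mathrm{rank}(k)$, and set $\phi_l(w)=x_1\cdots x_{j-1}\,x_{j+1}\cdots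 x_k\,0\,x_{k+1}\cdots x_n$. - If $x_{j-1}$ is subexcedent and either $x_{j+1}$ is non-subexcedent, or $x_{j+1}$ is subexcedent with $x_{j-1}<x_{j+1}$, then take the smallest $i\le j-1$ with $\mathrm{rank}(i)>x_i>\dots>x_{j-1}$, and set $\phi_l(w)=x_1\cdots x_{i-1}\,0\,x_i\cdots x_{j-1}\,x_{j+1}\cdots x_n$. - Otherwise $\phi_l(w)=w$. Put $\mathbf\Phi=\phi_1\phi_2\cdots\phi_n$ ($\phi_n$ is applied first). *The map $\mathbf F$.* For a word $w$ of non-negative integers with $\operatorname{des}w=0$ let $\mathbf F(w)=w$. Otherwise write $w=w'a0^rb$ with $a\ge1$, $b,r\ge0$ and define recursively: if $a\le b$, $\mathbf F(w)=\mathbf F(w'a0^r)\,b$; if $a>b$ and $r\ge1$, then $\mathbf F(w'a0^r)=w''0$ for some $w''$, and $\mathbf F(w)=0\,w''\,b$; if $a>b$ and $r=0$, $\mathbf F(w)=\delta(\mathbf F(w'a))\,b$, where $\delta$ moves each positive letter that immediately follows a maximal factor of zeros to the beginning of that factor. Then $\mathrm{ZDer}:S_n\to\mathcal S_n^{\mathrm{Der}}$,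 $\mathbf\Phi,\mathbf F:\mathcal S_n^{\mathrm{Der}}\to\mathcal S_n^{\mathrm{Der}}$ and $\Psi:S_n\to S_n$ are bijections, and $$\Psi=\mathrm{ZDer}^{-1}\circ\mathbf F\circ\mathbf\Phi^{-1}\circ\mathrm{ZDer}.$$ -/

import Mathlib

namespace FoataHan

/- Words are lists of natural numbers, letters are numbered from `1`; the letter `0` occurs in
shuffles only. -/

/-- The one-line word `σ(1) σ(2) ⋯ σ(n)` of a permutation, with letters in `{1, …, n}`. -/
def oneLine {n : ℕ} (σ : Equiv.Perm (Fin n)) : List ℕ :=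
  List.ofFn fun i => (σ i : ℕ) + 1

/-- `S_n`, as the set of one-line words of the permutations of an `n`-element set. -/
def permWords (n : ℕ) : Set (List ℕ) :=
  Set.range (oneLine (n := n))

/-- `D_n`, the one-line words of the derangements in `S_n`. -/
def derWords (n : ℕ) : Set (List ℕ) :=
  oneLine '' derangements (Fin n)

/-- The `i`-th letter `x_i` of `w = x_1 ⋯ x_n`, with the convention `x_0 = x_{n+1} = +∞`. -/
def letter (w : List ℕ) (i : ℕ) : ℕ∞ :=
  if i = 0 then ⊤ else (w[i - 1]?).elim ⊤ (fun x => (x : ℕ∞))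

/-- Number of descents `x_i > x_{i+1}`, `1 ≤ i ≤ n - 1`, of a word. -/
def des : List ℕ → ℕ
  | x :: y :: t => (if y < x then 1 else 0) + des (y :: t)
  | _ => 0

/-- The increasing list of the fixed points of a word, i.e. the `i ∈ [n]` with `x_i = i`. -/
def fixedList (w : List ℕ) : List ℕ :=
  (List.range' 1 w.length).filter fun i => letter w i = i

/-- The `rank` map of a set of letters: the increasing bijection from the (distinct) letters
of the word `y` onto `{1, …, m}`, evaluated at `x`. -/
def rankIn (y : List ℕ) (x : ℕ) : ℕ :=
  y.countP fun z => z ≤ x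

/-- The word of the non-fixed letters of `w`. -/
def movedLetters (w : List ℕ) : List ℕ :=
  ((List.range' 1 w.length).zip w).filterMap fun p => if p.2 = p.1 then none else some p.2

/-- The derangement part `Der(w)`: delete the fixed points, replace the letters by their ranks. -/
def der (w : List ℕ) : List ℕ :=
  (movedLetters w).map (rankIn (movedLetters w))

/-- `ZDer(w)`: replace each fixed point by `0` and each other letter by its rank among the
non-fixed letters. -/
def zder (w : List ℕ) : List ℕ :=
  ((List.range' 1 w.length).zip w).map fun p =>
    if p.2 = p.1 then 0 else rankIn (movedLetters w) p.2

/-- The shuffle class `Sh(0^k v)` of a word `v` with positive letters. -/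
def shuffles (k : ℕ) (v : List ℕ) : Set (List ℕ) :=
  {w | w.filter (fun x => x ≠ 0) = v ∧ w.count 0 = k}

/-- `S_n^Der`, the union of the `Sh(0^{n-m} v)` with `0 ≤ m ≤ n` and `v ∈ D_m`. -/
def sDer (n : ℕ) : Set (List ℕ) :=
  {w | ∃ m ≤ n, ∃ v ∈ derWords m, w ∈ shuffles (n - m) v}

/-! ### Insertion of fixed points and the bijection `Ψ` -/

/-- Insert the fixed point `i + 1` between the positions `i` and `i + 1`:
`x_1' ⋯ x_i' (i+1) x_{i+1}' ⋯ x_n'`, where `x' = x` if `x ≤ i` and `x' = x + 1` if `x > i`. -/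
def insertAt (w : List ℕ) (i : ℕ) : List ℕ :=
  (w.take i).map (fun x => if x ≤ i then x else x + 1) ++
    (i + 1) :: (w.drop i).map (fun x => if x ≤ i then x else x + 1)

/-- `(i, i+1)` is the `j`-th slot of `w`: `x_i ≠ i`, and `w` has `i - j` fixed points `f < i`. -/
def isSlot (w : List ℕ) (j i : ℕ) : Bool :=
  decide (letter w i ≠ i) && decide ((fixedList w).countP (fun f => f < i) + j = i)

/-- `⟨w, j⟩`: insert a fixed point into the `j`-th slot of `w`. (If there is no `j`-th slot,
nothing is inserted; this does not occur below.) -/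
def insertSlot (w : List ℕ) (j : ℕ) : List ℕ :=
  ((List.range (w.length + 1)).find? (isSlot w j)).elim w (insertAt w)

/-- `⟨σ, i_1, …, i_m⟩ = ⟨⟨σ, i_1, …, i_{m-1}⟩, i_m⟩`. -/
def insertSlots (σ : List ℕ) (I : List ℕ) : List ℕ :=
  I.foldl insertSlot σ

/-- The sequence `i_1 ≤ ⋯ ≤ i_m` such that the fixed points of `τ` are `i_1 + 1, …, i_m + m`. -/
def slotSeq (τ : List ℕ) : List ℕ :=
  (fixedList τ).mapIdx fun k f => f - (k + 1)

/-- The `j`-th slot of `σ` is green. -/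
def isGreen (σ : List ℕ) (j : ℕ) : Bool :=
  des (insertSlot σ j) = des σ

/-- The `j`-th slot of `σ` is red. -/
def isRed (σ : List ℕ) (j : ℕ) : Bool :=
  des (insertSlot σ j) = des σ + 1

/-- The value `g_j` of the `j`-th slot of a derangement `σ` of order `n`: the green slots get
the values `0, …, g` from right to left, the red slots get `g + 1, …, n` from left to right. -/
def slotValue (σ : List ℕ) (j : ℕ) : ℕ :=
  if isGreen σ j then (List.range' (j + 1) (σ.length - j)).countP (isGreen σ)
  else (List.range (σ.length + 1)).countP (isGreen σ) + (List.range j).countP (isRed σ)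

/-- The recursion that defines `Ψ⟨σ, i_1, …, i_m⟩ = ⟨σ, j_1, …, j_m⟩`; the argument is the
reversed sequence `i_m, …, i_1`, the value is `j_1, …, j_m`.

If the `i_m`-th slot is green, the value is `g_{i_m}` followed by the value at
`i_1, …, i_{m-1}`. If it is red and `k` is the number of final terms equal to `i_m`, the value is
`k - 1` terms `g_{i_m} - i_m`, then the value at `i_1, …, i_{m-k}` with all terms increased by
one (the empty sequence if `k = m`), then `g_{i_m}`. -/
def psiSeqRev (σ : List ℕ) : List ℕ → List ℕ
  | [] => []
  | i :: I =>
    if isGreen σ i then slotValue σ i :: psiSeqRev σ I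
    else
      List.replicate (I.takeWhile (· == i)).length (slotValue σ i - i) ++
        (psiSeqRev σ (I.dropWhile (· == i))).map (· + 1) ++ [slotValue σ i]
  termination_by I => I.length
  decreasing_by
  · simp
  · exact Nat.lt_succ_of_le (List.dropWhile_sublist _).length_le

/-- The bijection `Ψ` of Clarke et al.: write `τ = ⟨σ, i_1, …, i_m⟩` with `σ = Der(τ)`,
`i_1 ≤ ⋯ ≤ i_m`, and apply the recursion to the sequence. -/
def psi (τ : List ℕ) : List ℕ :=
  insertSlots (der τ) (psiSeqRev (der τ) (slotSeq τ).reverse)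

/-! ### The transformation `Φ` -/

/-- `rank(k)` for a position `k` of `w`: the number of positive letters at positions `≤ k`
(for `x_k > 0` this is the increasing bijection from the positions of the positive letters
onto `{1, …, m}`). -/
def posRank (w : List ℕ) (k : ℕ) : ℕ :=
  (w.take k).countP fun x => x ≠ 0

/-- The letter `x_k` is positive, and subexcedent: `x_k < rank(k)`. -/
def subexc (w : List ℕ) (k : ℕ) : Bool :=
  decide (letter w k ≠ 0) && decide (letter w k < posRank w k)

/-- Positions (from `1`) of the zeros of `w`, in increasing order. -/
def zeroPos (w : List ℕ) : List ℕ :=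
  (List.range' 1 w.length).filter fun j => letter w j = 0

/-- The `l`-th zero `x_j` moves to the right: `x_{j-1}` non-subexcedent, `x_{j+1}` subexcedent; or both subexcedent with
`x_{j-1} > x_{j+1}`. -/
def movesRight (w : List ℕ) (j : ℕ) : Bool :=
  subexc w (j + 1) && (!subexc w (j - 1) || decide (letter w (j + 1) < letter w (j - 1)))

/-- The `l`-th zero `x_j` moves to the left: `x_{j-1}` subexcedent, `x_{j+1}` non-subexcedent; or both subexcedent with
`x_{j-1} < x_{j+1}`. -/
def movesLeft (w : List ℕ) (j : ℕ) : Bool :=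
  subexc w (j - 1) && (!subexc w (j + 1) || decide (letter w (j - 1) < letter w (j + 1)))

/-- `x_{j+1} < x_{j+2} < ⋯ < x_k < rank(k)`. -/
def incrRun (w : List ℕ) (j k : ℕ) : Bool :=
  (List.range' (j + 1) (k - (j + 1))).all (fun s => letter w s < letter w (s + 1)) &&
    decide (letter w k < posRank w k)

/-- `rank(i) > x_i > x_{i+1} > ⋯ > x_{j-1}`. -/
def decrRun (w : List ℕ) (i j : ℕ) : Bool :=
  decide (letter w i < posRank w i) &&
    (List.range' i (j - 1 - i)).all (fun s => letter w (s + 1) < letter w s)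

/-- The greatest `k` with `j + 1 ≤ k ≤ n` and `x_{j+1} < ⋯ < x_k < rank(k)`. -/
def rightEnd (w : List ℕ) (j : ℕ) : ℕ :=
  ((List.range' (j + 1) (w.length - j)).reverse.find? (incrRun w j)).getD j

/-- The smallest `i` with `1 ≤ i ≤ j - 1` and `rank(i) > x_i > ⋯ > x_{j-1}`. -/
def leftEnd (w : List ℕ) (j : ℕ) : ℕ :=
  ((List.range' 1 (j - 1)).find? (fun i => decrRun w i j)).getD j

/-- `x_1 ⋯ x_{j-1} x_{j+1} ⋯ x_k 0 x_{k+1} ⋯ x_n`, for `x_j = 0` and `k ≥ j`. -/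
def shiftRight (w : List ℕ) (j k : ℕ) : List ℕ :=
  w.take (j - 1) ++ (w.drop j).take (k - j) ++ 0 :: w.drop k

/-- `x_1 ⋯ x_{i-1} 0 x_i ⋯ x_{j-1} x_{j+1} ⋯ x_n`, for `x_j = 0` and `i ≤ j`. -/
def shiftLeft (w : List ℕ) (i j : ℕ) : List ℕ :=
  w.take (i - 1) ++ 0 :: (w.drop (i - 1)).take (j - i) ++ w.drop j

/-- `φ_l`, acting on the `l`-th zero (`l ≥ 1`) of the word, and trivially if there is none. -/
def phi (l : ℕ) (w : List ℕ) : List ℕ :=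
  match (zeroPos w)[l - 1]? with
  | none => w
  | some j =>
    if movesRight w j then shiftRight w j (rightEnd w j)
    else if movesLeft w j then shiftLeft w (leftEnd w j) j
    else w

/-- `Φ = φ_1 φ_2 ⋯ φ_n` (so that `φ_n` is applied first), `n` being the length of the word. -/
def Phi (w : List ℕ) : List ℕ :=
  (List.range' 1 w.length).foldr phi w

/-! ### The transformation `F` -/

/-- `δ`, where the first argument is the number of zeros just read: each positive letter that
follows immediately a factor of zeros is moved to the beginning of that factor. -/
def deltaAux : ℕ → List ℕ → List ℕ
  | m, [] => List.replicate m 0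
  | m, 0 :: t => deltaAux (m + 1) t
  | m, (x + 1) :: t => (x + 1) :: (List.replicate m 0 ++ deltaAux 0 t)

/-- `δ(0^{m_1} x_1 v_1 ⋯ 0^{m_k} x_k v_k) = x_1 0^{m_1} v_1 ⋯ x_k 0^{m_k} v_k`. -/
def delta (w : List ℕ) : List ℕ :=
  deltaAux 0 w

/-- `γ(w'' 0) = 0 w''`. -/
def gamma (w : List ℕ) : List ℕ :=
  0 :: w.dropLast

/-- The recursion for `F`; the argument is the reversed word. For `w = w' a 0^r b` with
`des w ≥ 1`, `a ≥ 1`, the argument is `b :: u` with `u` the reversal of `w' a 0^r`. -/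
def foataHanRev : List ℕ → List ℕ
  | [] => []
  | b :: u =>
    if des (b :: u).reverse = 0 then (b :: u).reverse
    else if (u.dropWhile (· == 0)).headD 0 ≤ b then foataHanRev u ++ [b]
    else if 1 ≤ (u.takeWhile (· == 0)).length then gamma (foataHanRev u) ++ [b]
    else delta (foataHanRev u) ++ [b]

/-- Foata and Han's second transformation `F`. -/
def foataHanF (w : List ℕ) : List ℕ :=
  foataHanRev w.reverse

end FoataHan

namespace FoataHan

/-! ### Shuffles as slot contents -/

/-! A word of `sDer n` is a derangement word `v` of some order `p` together with the numbers `c 0,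
…, c p` of zeros in its `p + 1` slots; it is `place v c`. The maps `foataHanF` and `Phi`, and also
`psi` once transported by `zder`, keep `v` and change only `c`. The theorem is therefore a statement
about slot contents for a fixed `v`.

Given a colouring of the slots, `evolve` reads them from left to right. A green slot with `a` zeros
shifts the contents built so far by one slot and puts `a` zeros into slot `0`. An empty red slot
does nothing. A red slot `j` with `a ≥ 1` zeros shifts likewise, puts `a - 1` zeros into slot `0`
and leaves one in slot `j`. This operation is injective and keeps the number of zeros.

Two colourings occur. In `zeroGreen` a slot is green if a zero inserted there creates no descent, in
`fixGreen` if a fixed point inserted there creates none. The recursion for `foataHanF` is `evolve`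
for `zeroGreen` (`foataHanF_place`). The recursion for `psi` is `evolve` for `fixGreen`
(`count_psiSeqRev`, `psi_spec`), because inserting a fixed point into a permutation inserts a zero
into its image under `zder` (`zder_insertAt`, `insertSlots_spec`). Finally `Phi` converts one
colouring into the other: if it takes `c` to `c'`, then `evolve` for `zeroGreen` at `c` equals
`evolve` for `fixGreen` at `c'` (`exists_Phi_place`, from the induction `exists_phiTo_place`). Hence
`zder (psi τ) = foataHanF w` whenever `Phi w = zder τ`.

Injectivity of `evolve` makes `Phi` and `foataHanF` injective on the finite set `sDer n`, hence
bijective. Since `zder` is bijective too, `psi` is a composition of bijections. -/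

/-- The shuffle `0^{c 0} v_1 0^{c 1} ⋯ v_p 0^{c p}`. -/
def place : List ℕ → (ℕ → ℕ) → List ℕ
  | [], c => List.replicate (c 0) 0
  | x :: v, c => List.replicate (c 0) 0 ++ x :: place v fun i => c (i + 1)

theorem place_snoc (v : List ℕ) (x : ℕ) (c : ℕ → ℕ) :
    place (v ++ [x]) c = place v c ++ x :: List.replicate (c (v.length + 1)) 0 := by
  induction v generalizing c with
  | nil => simp [place]
  | cons a v ih => simp [place, ih]

theorem place_congr {v : List ℕ} {c d : ℕ → ℕ} (h : ∀ i ≤ v.length, c i = d i) :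
    place v c = place v d := by
  induction v generalizing c d with
  | nil => simp [place, h 0 (by simp)]
  | cons a v ih =>
    simp only [place]
    rw [h 0 (by simp), ih (d := fun i => d (i + 1))]
    intro i hi
    exact h (i + 1) (by simpa using hi)

theorem filter_place {v : List ℕ} (hv : ∀ x ∈ v, x ≠ 0) (c : ℕ → ℕ) :
    (place v c).filter (fun x => x ≠ 0) = v := by
  induction v generalizing c with
  | nil => simp [place]
  | cons a v ih =>
    have := ih (fun x hx => hv x (by simp [hx])) (fun i => c (i + 1))
    have ha : a ≠ 0 := hv a (by simp)
    simp only [place, List.filter_append, List.filter_cons]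
    rw [this]
    simp [ha]

theorem count_zero_place {v : List ℕ} (hv : ∀ x ∈ v, x ≠ 0) (c : ℕ → ℕ) :
    (place v c).count 0 = ∑ i ∈ Finset.range (v.length + 1), c i := by
  induction v generalizing c with
  | nil => simp [place]
  | cons a v ih =>
    have := ih (fun x hx => hv x (by simp [hx])) (fun i => c (i + 1))
    have ha : a ≠ 0 := hv a (by simp)
    simp only [place, List.count_append, List.count_cons, this, List.length_cons]
    rw [Finset.sum_range_succ' _ (v.length + 1)]
    simp [ha, add_comm]

theorem place_injective {v : List ℕ} (hv : ∀ x ∈ v, x ≠ 0) {c d : ℕ → ℕ}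
    (h : place v c = place v d) : ∀ i ≤ v.length, c i = d i := by
  induction v using List.reverseRecOn generalizing c d with
  | nil =>
    intro i hi
    obtain rfl : i = 0 := by simpa using hi
    simpa [place] using congrArg List.length h
  | append_singleton v x ih =>
    have hx : x ≠ 0 := hv x (by simp)
    have hv' : ∀ y ∈ v, y ≠ 0 := fun y hy => hv y (by simp [hy])
    rw [place_snoc, place_snoc] at h
    -- The number of trailing zeros, the content of the last slot, is recovered by reading the word
    -- backwards up to the positive letter `x`.
    have key : ∀ (k : ℕ) (l : List ℕ),
        (l ++ x :: List.replicate k 0).reverse.takeWhile (· == 0) = List.replicate k 0 := by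
      intro k l
      rw [List.reverse_append, List.reverse_cons, List.reverse_replicate, List.append_assoc,
        List.takeWhile_append_of_pos (by simp)]
      simp [hx]
    have h1 := key (c (v.length + 1)) (place v c)
    rw [h, key] at h1
    have h2 : c (v.length + 1) = d (v.length + 1) := by
      simpa using (congrArg List.length h1).symm
    rw [h2] at h
    have h3 := ih hv' (List.append_cancel_right h)
    intro i hi
    rcases Nat.lt_or_ge v.length i with h4 | h4
    · obtain rfl : i = v.length + 1 := by simp at hi; omega
      exact h2
    · exact h3 i h4

/-- The slots occupied by the zeros of a word whose zeros are at the given positions. -/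
def slotsOf (P : List ℕ) : List ℕ :=
  P.mapIdx fun k f => f - (k + 1)

theorem letter_append_left {z t : List ℕ} {i : ℕ} (h : i ≤ z.length) (h0 : i ≠ 0) :
    letter (z ++ t) i = letter z i := by
  unfold letter
  rw [List.getElem?_append_left (by omega)]

theorem letter_append_right (z t : List ℕ) {i : ℕ} (h : i ≠ 0) :
    letter (z ++ t) (z.length + i) = letter t i := by
  unfold letter
  rw [List.getElem?_append_right (by omega), if_neg (by omega), if_neg h]
  congr 2
  omega

theorem zeroPos_append (z t : List ℕ) :
    zeroPos (z ++ t) = zeroPos z ++ (zeroPos t).map (· + z.length) := by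
  unfold zeroPos
  rw [List.length_append, List.range'_append_1.symm, List.filter_append]
  congr 1
  · apply List.filter_congr
    intro i hi
    simp only [List.mem_range'_1] at hi
    rw [letter_append_left (by omega) (by omega)]
  · rw [show 1 + z.length = z.length + 1 by omega, List.range'_eq_map_range, List.range'_eq_map_range,
      List.filter_map, List.filter_map, List.map_map]
    have : ((fun x => x + z.length) ∘ fun x => 1 + x) = fun x => z.length + 1 + x := by
      funext x; simp; omega
    rw [this]
    congr 1
    apply List.filter_congr
    intro i hi
    simp only [Function.comp_apply]
    rw [add_assoc, letter_append_right _ _ (by omega)]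

theorem length_zeroPos (z : List ℕ) : (zeroPos z).length = z.count 0 := by
  induction z using List.reverseRecOn with
  | nil => rfl
  | append_singleton z x ih =>
    rw [zeroPos_append, List.length_append, ih, List.count_append]
    by_cases hx : x = 0 <;> simp [zeroPos, letter, hx]

/-- The position of a zero minus the number of zeros up to and including it is the number of
positive letters before it, that is, its slot. -/
theorem slotsOf_zeroPos_snoc (z : List ℕ) (x : ℕ) :
    slotsOf (zeroPos (z ++ [x])) = slotsOf (zeroPos z) ++ if x = 0 then [z.length - z.count 0] else [] := by
  rw [zeroPos_append]
  by_cases hx : x = 0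
  · simp [zeroPos, letter, hx, slotsOf, List.mapIdx_append, ← length_zeroPos]
    omega
  · simp [zeroPos, letter, hx, slotsOf]

theorem length_sub_count_zero (z : List ℕ) :
    z.length - z.count 0 = (z.filter fun x => x ≠ 0).length := by
  induction z with
  | nil => rfl
  | cons a z ih =>
    have := List.count_le_length (a := 0) (l := z)
    by_cases ha : a = 0
    · simp [ha] at ih ⊢; omega
    · simp [ha] at ih ⊢; omega

theorem slotsOf_le (z : List ℕ) :
    ∀ i ∈ slotsOf (zeroPos z), i ≤ (z.filter fun x => x ≠ 0).length := by
  induction z using List.reverseRecOn with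
  | nil => simp [zeroPos, slotsOf]
  | append_singleton z x ih =>
    rw [slotsOf_zeroPos_snoc, length_sub_count_zero]
    intro i hi
    rw [List.mem_append] at hi
    rw [List.filter_append, List.length_append]
    rcases hi with hi | hi
    · exact (ih i hi).trans (by omega)
    · split_ifs at hi
      · rw [List.mem_singleton] at hi; omega
      · simp at hi

theorem slotsOf_sorted (z : List ℕ) : (slotsOf (zeroPos z)).Pairwise (· ≤ ·) := by
  induction z using List.reverseRecOn with
  | nil => simp [zeroPos, slotsOf]
  | append_singleton z x ih =>
    rw [slotsOf_zeroPos_snoc, length_sub_count_zero]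
    refine List.pairwise_append.2 ⟨ih, by split_ifs <;> simp, ?_⟩
    intro a ha b hb
    split_ifs at hb
    · rw [List.mem_singleton] at hb; rw [hb]; exact slotsOf_le z a ha
    · simp at hb

/-- Every word is the shuffle of its zeros and its positive letters. -/
theorem place_slotsOf (z : List ℕ) :
    place (z.filter fun x => x ≠ 0) (fun i => (slotsOf (zeroPos z)).count i) = z := by
  induction z using List.reverseRecOn with
  | nil => rfl
  | append_singleton z x ih =>
    have hle := slotsOf_le z
    rw [slotsOf_zeroPos_snoc, length_sub_count_zero]
    set v := z.filter fun x => x ≠ 0 with hv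
    by_cases hx : x = 0
    · subst hx
      rw [List.filter_append, ← hv]
      simp only [ne_eq, not_true_eq_false, decide_false, Bool.false_eq_true, not_false_eq_true, List.filter_cons_of_neg,
        List.filter_nil, List.append_nil, if_true, List.count_append]
      conv_rhs => rw [← ih]
      have aux : ∀ (v : List ℕ) (c d : ℕ → ℕ), (∀ i < v.length, c i = d i) →
          d v.length = c v.length + 1 → place v d = place v c ++ [0] := by
        intro v c d h1 h2
        rcases List.eq_nil_or_concat v with rfl | ⟨l, a, rfl⟩
        · simp at h2; simp [place, h2, List.replicate_succ']
        · rw [List.concat_eq_append, place_snoc, place_snoc]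
          rw [List.concat_eq_append, List.length_append, List.length_singleton] at h1 h2
          rw [h2, List.replicate_succ', place_congr (c := d) (d := c)]
          · simp
          · intro i hi; exact (h1 i (by omega)).symm
      apply aux
      · intro i hi
        rw [List.count_cons_of_ne (by omega)]; simp
      · simp
    · rw [List.filter_append, ← hv]
      simp only [ne_eq, hx, not_false_eq_true, decide_true, List.filter_cons_of_pos, List.filter_nil, if_false,
        List.append_nil]
      -- The slot opened by the new positive letter is empty, since all earlier zeros lie in slots
      -- `≤ v.length`.
      rw [place_snoc, List.count_eq_zero_of_not_mem, ih]
      · rfl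
      · intro h
        have := hle _ h
        omega

/-! ### The evolution of slot contents -/

/-- The contents `f` of the slots, shifted by one, with `a` zeros in slot `0`. -/
def push (a : ℕ) (f : ℕ → ℕ) : ℕ → ℕ
  | 0 => a
  | i + 1 => f i

@[simp] theorem push_zero (a : ℕ) (f : ℕ → ℕ) : push a f 0 = a := rfl

@[simp] theorem push_succ (a : ℕ) (f : ℕ → ℕ) (i : ℕ) : push a f (i + 1) = f i := rfl

theorem push_add_single (a : ℕ) (f : ℕ → ℕ) (i : ℕ) :
    push a (f + Pi.single i 1) = push a f + Pi.single (i + 1) 1 := by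
  funext j
  cases j <;> simp [Pi.single_apply]

theorem push_injective {a b : ℕ} {f g : ℕ → ℕ} (h : push a f = push b g) : a = b ∧ f = g :=
  ⟨congrFun h 0, funext fun i => congrFun h (i + 1)⟩

/-- The contents produced from `c` by reading the slots `< j`, the slot `i` being green if
`χ i`. -/
def evolve (χ : ℕ → Bool) (c : ℕ → ℕ) : ℕ → ℕ → ℕ
  | 0 => 0
  | j + 1 =>
    if χ j then push (c j) (evolve χ c j)
    else if c j = 0 then evolve χ c j
    else push (c j - 1) (evolve χ c j) + Pi.single j 1

theorem evolve_succ_green {χ : ℕ → Bool} {j : ℕ} (h : χ j = true) (c : ℕ → ℕ) :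
    evolve χ c (j + 1) = push (c j) (evolve χ c j) := by
  simp [evolve, h]

theorem evolve_succ_red_zero {χ : ℕ → Bool} {c : ℕ → ℕ} {j : ℕ} (h : χ j = false) (hc : c j = 0) :
    evolve χ c (j + 1) = evolve χ c j := by
  simp [evolve, h, hc]

theorem evolve_succ_red {χ : ℕ → Bool} {c : ℕ → ℕ} {j k : ℕ} (h : χ j = false)
    (hc : c j = k + 1) :
    evolve χ c (j + 1) = push k (evolve χ c j) + Pi.single j 1 := by
  simp [evolve, h, hc]

/-- After `j` slots have been read, only the slots `< j` can be occupied: each step shifts by at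
most one, and the extra zero of a red slot `j` goes to slot `j` itself. -/
theorem evolve_eq_zero (χ : ℕ → Bool) (c : ℕ → ℕ) {j i : ℕ} (h : j ≤ i) : evolve χ c j i = 0 := by
  induction j generalizing i with
  | zero => rfl
  | succ j ih =>
    obtain ⟨i, rfl⟩ : ∃ k, i = k + 1 := ⟨i - 1, by omega⟩
    simp only [evolve]
    split_ifs
    · exact ih (by omega)
    · exact ih (by omega)
    · simp [ih (show j ≤ i by omega), Pi.single_apply]; omega

theorem evolve_congr {χ ψ : ℕ → Bool} {c d : ℕ → ℕ} {j : ℕ} (h : ∀ i < j, χ i = ψ i)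
    (h' : ∀ i < j, c i = d i) : evolve χ c j = evolve ψ d j := by
  induction j with
  | zero => rfl
  | succ j ih =>
    simp only [evolve]
    rw [ih (fun i hi => h i (by omega)) (fun i hi => h' i (by omega)), h j (by omega), h' j (by omega)]

/-- Each step can be undone. The colour of slot `j` is given, and for a red slot the result at index
`j` tells whether the slot was empty: it is `0` if so, and at least `1` otherwise. -/
theorem evolve_injective {χ : ℕ → Bool} {c d : ℕ → ℕ} {j : ℕ}
    (h : evolve χ c j = evolve χ d j) : ∀ i < j, c i = d i := by
  induction j with
  | zero => simp
  | succ j ih =>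
    have key : c j = d j ∧ evolve χ c j = evolve χ d j := by
      have h1 := evolve_eq_zero χ c (le_refl j)
      have h2 := evolve_eq_zero χ d (le_refl j)
      simp only [evolve] at h
      split_ifs at h with h3 h4 h5 h5
      · exact push_injective h
      · exact ⟨by omega, h⟩
      · have := congrFun h j
        simp [h1] at this
      · have := congrFun h j
        simp [h2] at this
      · obtain ⟨h6, h7⟩ := push_injective (add_right_cancel h)
        exact ⟨by omega, h7⟩
    intro i hi
    rcases Nat.lt_succ_iff_lt_or_eq.1 hi with hi | rfl
    · exact ih key.2 i hi
    · exact key.1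

theorem sum_push (a : ℕ) (f : ℕ → ℕ) (j : ℕ) :
    ∑ i ∈ Finset.range (j + 1), push a f i = (∑ i ∈ Finset.range j, f i) + a := by
  rw [Finset.sum_range_succ']
  rfl

/-- Conservation of the number of zeros; this is what keeps `Phi` and `foataHanF` inside `sDer n`.
-/
theorem sum_evolve (χ : ℕ → Bool) (c : ℕ → ℕ) (j : ℕ) :
    ∑ i ∈ Finset.range j, evolve χ c j i = ∑ i ∈ Finset.range j, c i := by
  induction j with
  | zero => simp
  | succ j ih =>
    rw [Finset.sum_range_succ c j, ← ih]
    simp only [evolve]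
    split_ifs with h1 h2
    · exact sum_push ..
    · rw [Finset.sum_range_succ, evolve_eq_zero χ c le_rfl, h2]
    · simp only [Pi.add_apply, Finset.sum_add_distrib]
      rw [sum_push]
      simp only [Pi.single_apply, Finset.sum_ite_eq']
      simp; omega

theorem place_push (v : List ℕ) (a : ℕ) (f : ℕ → ℕ) :
    place v (push a f) = List.replicate a 0 ++ place v (push 0 f) := by
  cases v <;> simp [place]

theorem cons_place_push (v : List ℕ) (a : ℕ) (f : ℕ → ℕ) :
    0 :: place v (push a f) = place v (push (a + 1) f) := by
  rw [place_push v a, place_push v (a + 1)]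
  simp [List.replicate_succ]

theorem push_eta (c : ℕ → ℕ) : push (c 0) (fun i => c (i + 1)) = c := by
  funext i
  cases i <;> rfl

/-- With `cons_place_push` this describes `gamma`: the final zero leaves the last slot and joins
slot `0`. -/
theorem place_add_single_length (v : List ℕ) (c : ℕ → ℕ) :
    place v (c + Pi.single v.length 1) = place v c ++ [0] := by
  rcases List.eq_nil_or_concat v with rfl | ⟨l, a, rfl⟩
  · simp [place, List.replicate_succ']
  · rw [List.concat_eq_append, place_snoc, place_snoc]
    simp only [List.length_append, List.length_singleton, Pi.add_apply, Pi.single_eq_same,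
      List.replicate_succ']
    rw [place_congr (c := c + Pi.single (l.length + 1) 1) (d := c)]
    · simp
    · intro i hi
      simp [Pi.single_apply]; omega

/-! ### Descents -/

theorem des_append_cons (l : List ℕ) (a b : ℕ) (t : List ℕ) :
    des (l ++ a :: b :: t) = des (l ++ [a]) + (if b < a then 1 else 0) + des (b :: t) := by
  induction l with
  | nil => simp [des]
  | cons x l ih =>
    cases l with
    | nil => simp [des]; omega
    | cons y l =>
      simp only [List.cons_append, des] at ih ⊢
      rw [ih]
      omega

/-- A word without descents falls under the case `a ≤ b` of the recursion for `F`, the default `0`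
standing for a missing `a`. The separate base case thus becomes superfluous. -/
theorem headD_dropWhile_le {u : List ℕ} {b : ℕ} (h : des (b :: u).reverse = 0) :
    (u.dropWhile (· == 0)).headD 0 ≤ b := by
  induction u generalizing b with
  | nil => simp
  | cons a u ih =>
    rw [List.reverse_cons, List.reverse_cons, List.append_assoc, List.singleton_append,
      des_append_cons] at h
    have hab : a ≤ b := by
      by_contra hab
      rw [if_pos (by omega)] at h
      omega
    have h2 := ih (b := a) (by rw [List.reverse_cons]; omega)
    by_cases ha : a = 0
    · subst ha
      simp only [List.dropWhile_cons, beq_self_eq_true, if_true]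
      omega
    · simpa [List.dropWhile_cons, ha] using hab

theorem des_reverse_tail {u : List ℕ} {b : ℕ} (h : des (b :: u).reverse = 0) :
    des u.reverse = 0 := by
  cases u with
  | nil => rfl
  | cons a u =>
    rw [List.reverse_cons, List.reverse_cons, List.append_assoc, List.singleton_append,
      des_append_cons] at h
    rw [List.reverse_cons]
    omega

theorem foataHanRev_of_des_eq_zero {u : List ℕ} (h : des u.reverse = 0) :
    foataHanRev u = u.reverse := by
  cases u with
  | nil => rfl
  | cons b u => simp only [foataHanRev, h, if_true]

/-- The recursion for `F` holds also for words without descents. -/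
theorem foataHanRev_cons (b : ℕ) (u : List ℕ) :
    foataHanRev (b :: u) =
      if (u.dropWhile (· == 0)).headD 0 ≤ b then foataHanRev u ++ [b]
      else if 1 ≤ (u.takeWhile (· == 0)).length then gamma (foataHanRev u) ++ [b]
      else delta (foataHanRev u) ++ [b] := by
  by_cases h : des (b :: u).reverse = 0
  · rw [if_pos (headD_dropWhile_le h), foataHanRev_of_des_eq_zero h,
      foataHanRev_of_des_eq_zero (des_reverse_tail h), List.reverse_cons]
  · rw [foataHanRev, if_neg h]

theorem foataHanF_replicate (r : ℕ) : foataHanF (List.replicate r 0) = List.replicate r 0 := by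
  unfold foataHanF
  rw [List.reverse_replicate]
  induction r with
  | zero => rfl
  | succ r ih =>
    rw [List.replicate_succ, foataHanRev_cons, if_pos, ih, ← List.replicate_succ', List.replicate_succ]
    simp

theorem foataHanF_replicate_append (r b : ℕ) :
    foataHanF (List.replicate r 0 ++ [b]) = List.replicate r 0 ++ [b] := by
  conv_rhs => rw [← foataHanF_replicate]
  unfold foataHanF
  rw [List.reverse_append, List.reverse_singleton, List.singleton_append, foataHanRev_cons, if_pos]
  simp

theorem foataHanF_append (w : List ℕ) {a : ℕ} (ha : a ≠ 0) (r b : ℕ) :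
    foataHanF (w ++ a :: List.replicate r 0 ++ [b]) =
      (if a ≤ b then foataHanF (w ++ a :: List.replicate r 0)
      else if 1 ≤ r then gamma (foataHanF (w ++ a :: List.replicate r 0))
      else delta (foataHanF (w ++ a :: List.replicate r 0))) ++ [b] := by
  unfold foataHanF
  rw [List.reverse_append, List.reverse_singleton, List.singleton_append, foataHanRev_cons]
  have h1 : ((w ++ a :: List.replicate r 0).reverse.dropWhile (· == 0)).headD 0 = a := by
    rw [List.reverse_append, List.reverse_cons, List.reverse_replicate, List.append_assoc,
      List.dropWhile_append_of_pos (by simp)]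
    simp [ha]
  have h2 : ((w ++ a :: List.replicate r 0).reverse.takeWhile (· == 0)).length = r := by
    rw [List.reverse_append, List.reverse_cons, List.reverse_replicate, List.append_assoc,
      List.takeWhile_append_of_pos (by simp)]
    simp [ha]
  rw [h1, h2]
  split_ifs <;> rfl

theorem deltaAux_replicate (m k : ℕ) (t : List ℕ) :
    deltaAux m (List.replicate k 0 ++ t) = deltaAux (m + k) t := by
  induction k generalizing m with
  | zero => rfl
  | succ k ih =>
    rw [List.replicate_succ, List.cons_append, deltaAux, ih]
    congr 1
    omega

/-- Moving each positive letter in front of the zeros that precede it transfers these zeros to the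
next slot, so `delta` is a shift by one. Trailing zeros have no letter to cross, whence the
condition on the last slot. -/
theorem delta_place {v : List ℕ} (hv : ∀ x ∈ v, x ≠ 0) {c : ℕ → ℕ} (hc : c v.length = 0) :
    delta (place v c) = place v (push 0 c) := by
  unfold delta
  induction v generalizing c with
  | nil =>
    simp at hc
    simp [place, deltaAux, hc]
  | cons x v ih =>
    obtain ⟨y, rfl⟩ : ∃ y, x = y + 1 := ⟨x - 1, by have := hv x (by simp); omega⟩
    rw [place, deltaAux_replicate, deltaAux, ih (fun z hz => hv z (by simp [hz])) hc, ← place_push,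
      zero_add, push_eta]
    simp [place]

/-! ### `F` in terms of slot contents -/

/-- Colours of the slots of `v` with respect to the insertion of a zero: a slot is green if this
creates no descent. -/
def zeroGreen (v : List ℕ) (j : ℕ) : Bool :=
  decide (j = 0 ∨ (j < v.length ∧ v.getD j 0 < v.getD (j - 1) 0))

/-- Only the last slot can be recoloured by a new letter: it is red when `v` is nonempty, and
becomes a slot between two letters. -/
theorem zeroGreen_snoc {v : List ℕ} {x j : ℕ} (h : j < v.length) :
    zeroGreen (v ++ [x]) j = zeroGreen v j := by
  unfold zeroGreen
  rw [List.getD_append _ _ _ _ h, List.getD_append _ _ _ _ (by omega)]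
  simp only [List.length_append, List.length_singleton]
  congr 2
  simp [h, h.trans (Nat.lt_succ_self _)]

/-- The first zero after `x` triggers `delta`, a shift by one. Each further zero triggers `gamma`,
which carries the previous trailing zero to slot `0`. So `r + 1` zeros leave `r` in slot `0` and one
at the end, as for a red slot. -/
theorem foataHanF_place_snoc_zeros {v : List ℕ} {x : ℕ} (hv : ∀ y ∈ v ++ [x], y ≠ 0)
    {w : List ℕ} {N : ℕ → ℕ} (hN : N (v.length + 1) = 0)
    (h : foataHanF (w ++ [x]) = place (v ++ [x]) N) (r : ℕ) :
    foataHanF (w ++ x :: List.replicate (r + 1) 0) =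
      place (v ++ [x]) (push r N + Pi.single (v.length + 1) 1) := by
  have hx : x ≠ 0 := hv x (by simp)
  have hlen : v.length + 1 = (v ++ [x]).length := by simp
  induction r with
  | zero =>
    have := foataHanF_append w hx 0 0
    rw [if_neg (by omega), if_neg (by omega)] at this
    simp only [List.replicate_zero] at this
    rw [h, delta_place hv (by rw [← hlen]; exact hN), ← place_add_single_length, ← hlen] at this
    simpa using this
  | succ r ih =>
    have := foataHanF_append w hx (r + 1) 0
    rw [if_neg (by omega), if_pos (by omega), ih, hlen, place_add_single_length, gamma,
      List.dropLast_concat, cons_place_push, ← place_add_single_length, ← hlen] at this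
    rw [← this, List.replicate_succ' (n := r + 1)]
    simp

/-- Induction on the last letter `x`. The slot before `x` has been read as the last, red slot of
`v`. Appending `x` either confirms this colour or turns it green, and the three cases of `foataHanF`
make exactly the necessary correction. -/
theorem foataHanF_place {v : List ℕ} (hv : ∀ x ∈ v, x ≠ 0) (c : ℕ → ℕ) :
    foataHanF (place v c) = place v (evolve (zeroGreen v) c (v.length + 1)) := by
  induction v using List.reverseRecOn generalizing c with
  | nil =>
    rw [place, foataHanF_replicate]
    simp [place, evolve, zeroGreen]
  | append_singleton v x ih =>
    have hx : x ≠ 0 := hv x (by simp)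
    have hlen : (v ++ [x]).length = v.length + 1 := by simp
    have hv' : ∀ y ∈ v, y ≠ 0 := fun y hy => hv y (by simp [hy])
    set N := evolve (zeroGreen (v ++ [x])) c (v.length + 1) with hNdef
    have hN : N (v.length + 1) = 0 := evolve_eq_zero _ _ le_rfl
    have key : foataHanF (place v c ++ [x]) = place (v ++ [x]) N := by
      rw [place_snoc, hN, List.replicate_zero]
      rcases List.eq_nil_or_concat v with rfl | ⟨l, a, rfl⟩
      · simp only [place]
        rw [foataHanF_replicate_append]
        simp [hNdef, evolve, zeroGreen]
      · rw [List.concat_eq_append] at *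
        have ha : a ≠ 0 := hv' a (by simp)
        have hlen' : (l ++ [a]).length = l.length + 1 := by simp
        have hevol : evolve (zeroGreen (l ++ [a] ++ [x])) c (l.length + 1) =
            evolve (zeroGreen (l ++ [a])) c (l.length + 1) :=
          evolve_congr (fun i hi => zeroGreen_snoc (by omega)) fun _ _ => rfl
        have hred : zeroGreen (l ++ [a]) (l.length + 1) = false := by
          simp [zeroGreen]
        have hcol : zeroGreen (l ++ [a] ++ [x]) (l.length + 1) = decide (x < a) := by
          simp [zeroGreen, List.getD_eq_getElem?_getD]
        have hzero : evolve (zeroGreen (l ++ [a])) c (l.length + 1) (l ++ [a]).length = 0 :=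
          evolve_eq_zero _ _ (by omega)
        have hF := ih hv' c
        rw [hlen'] at hF hNdef
        rw [place_snoc] at hF ⊢
        rw [foataHanF_append _ ha, hF]
        congr 1
        -- If `x < a` the slot turns green. When it is empty, reading it as red had done nothing,
        -- and `delta` supplies the missing shift. When it has `k + 1` zeros, the red reading had
        -- put `k` in front and one at the end, and `gamma` brings the latter to the front.
        rcases Nat.lt_or_ge x a with hxa | hxa
        · rw [if_neg (by omega)]
          rw [hNdef, evolve_succ_green (χ := zeroGreen (l ++ [a] ++ [x])) (by rw [hcol]; simpa using hxa),
            hevol]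
          rcases Nat.eq_zero_or_pos (c (l.length + 1)) with hc | hc
          · rw [if_neg (by omega), hc, evolve_succ_red_zero hred hc, delta_place hv' hzero]
          · obtain ⟨k, hk⟩ : ∃ k, c (l.length + 1) = k + 1 := ⟨_, (Nat.sub_add_cancel hc).symm⟩
            rw [if_pos (by omega), evolve_succ_red hred hk, ← hlen', place_add_single_length, gamma,
              List.dropLast_concat, cons_place_push, hlen', hk]
        · rw [if_pos hxa, hNdef]
          have hcol' : zeroGreen (l ++ [a] ++ [x]) (l.length + 1) = false := by
            rw [hcol]; simpa using hxa
          simp only [evolve, hcol', hred]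
          simp only [evolve] at hevol
          rw [hevol]
    rw [place_snoc, hlen]
    have hred : zeroGreen (v ++ [x]) (v.length + 1) = false := by
      simp [zeroGreen]
    rcases Nat.eq_zero_or_pos (c (v.length + 1)) with hc | hc
    · rw [evolve_succ_red_zero hred hc, hc, ← hNdef, ← key]
      rfl
    · obtain ⟨k, hk⟩ : ∃ k, c (v.length + 1) = k + 1 := ⟨_, (Nat.sub_add_cancel hc).symm⟩
      rw [evolve_succ_red hred hk, hk, foataHanF_place_snoc_zeros hv hN key]

/-! ### The local action of `φ_l` -/

/-- Number of positive letters. -/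
def pos (u : List ℕ) : ℕ := u.countP fun x => x ≠ 0

@[simp] theorem pos_nil : pos [] = 0 := rfl

@[simp] theorem pos_append (u t : List ℕ) : pos (u ++ t) = pos u + pos t := List.countP_append

@[simp] theorem pos_cons (x : ℕ) (t : List ℕ) : pos (x :: t) = pos t + if x = 0 then 0 else 1 := by
  by_cases hx : x = 0 <;> simp [pos, hx]

theorem pos_eq_length {s : List ℕ} (hs : ∀ x ∈ s, x ≠ 0) : pos s = s.length := by
  simpa [pos] using hs

theorem pos_replicate_zero (k : ℕ) : pos (List.replicate k 0) = 0 := by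
  simp [pos]

theorem pos_reverse (u : List ℕ) : pos u.reverse = pos u := by
  simp [pos]

theorem letter_succ {w : List ℕ} {i : ℕ} (h : i < w.length) : letter w (i + 1) = (w[i] : ℕ∞) := by
  simp [letter, h]

theorem letter_eq_top {w : List ℕ} {i : ℕ} (h : w.length < i) : letter w i = ⊤ := by
  unfold letter
  rw [List.getElem?_eq_none (by omega)]
  simp

theorem letter_append_cons (u : List ℕ) (x : ℕ) (t : List ℕ) :
    letter (u ++ x :: t) (u.length + 1) = (x : ℕ∞) := by
  rw [letter_succ (by simp)]
  simp

theorem posRank_append (u t : List ℕ) : posRank (u ++ t) u.length = pos u := by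
  simp [posRank, pos]

theorem posRank_append_cons (u : List ℕ) (x : ℕ) (t : List ℕ) :
    posRank (u ++ x :: t) (u.length + 1) = pos u + if x = 0 then 0 else 1 := by
  have := posRank_append (u ++ [x]) t
  simpa using this

theorem posRank_succ_le (w : List ℕ) (k : ℕ) : posRank w (k + 1) ≤ posRank w k + 1 := by
  unfold posRank
  rcases Nat.lt_or_ge k w.length with h | h
  · rw [List.take_succ_eq_append_getElem h, List.countP_append]
    have := List.countP_le_length (p := fun x => decide (x ≠ 0)) (l := [w[k]])
    simp only [List.length_singleton] at this
    omega
  · rw [List.take_of_length_le h, List.take_of_length_le (by omega)]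
    omega

theorem posRank_mono (w : List ℕ) {i k : ℕ} (h : i ≤ k) : posRank w i ≤ posRank w k := by
  unfold posRank
  exact (List.take_sublist_take_left h).countP_le

/-- The rank of a positive letter counts the letter itself, so `x < rank` becomes `x ≤ pos u`. -/
theorem subexc_append_cons (u : List ℕ) (x : ℕ) (t : List ℕ) :
    subexc (u ++ x :: t) (u.length + 1) = decide (x ≠ 0 ∧ x ≤ pos u) := by
  unfold subexc
  rw [letter_append_cons, posRank_append_cons, Bool.eq_iff_iff]
  by_cases hx : x = 0
  · simp [hx]
  · simp only [hx, if_false, Bool.and_eq_true, decide_eq_true_eq, Nat.cast_lt]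
    simp [hx]

theorem subexc_zero (w : List ℕ) : subexc w 0 = false := by
  simp [subexc, letter]

theorem subexc_of_length_lt {w : List ℕ} {i : ℕ} (h : w.length < i) : subexc w i = false := by
  simp [subexc, letter_eq_top h]

theorem find?_range'_eq {p : ℕ → Bool} {s n i : ℕ} (h1 : s ≤ i) (h2 : i < s + n) (hp : p i = true)
    (h : ∀ k, s ≤ k → k < i → p k = false) : (List.range' s n).find? p = some i := by
  induction n generalizing s with
  | zero => omega
  | succ n ih =>
    rw [List.range'_succ]
    rcases Nat.eq_or_lt_of_le h1 with rfl | h3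
    · simp [hp]
    · rw [List.find?_cons, h s le_rfl h3]
      exact ih h3 (by omega) fun k hk => h k (by omega)

theorem find?_range'_reverse_eq {p : ℕ → Bool} {s n i : ℕ} (h1 : s ≤ i) (h2 : i < s + n)
    (hp : p i = true) (h : ∀ k, i < k → k < s + n → p k = false) :
    (List.range' s n).reverse.find? p = some i := by
  induction n with
  | zero => omega
  | succ n ih =>
    rw [List.range'_concat, List.reverse_append, List.reverse_singleton, List.singleton_append, one_mul]
    rcases Nat.eq_or_lt_of_le (show i ≤ s + n by omega) with rfl | h3
    · simp [hp]
    · rw [List.find?_cons, h _ h3 (by omega)]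
      exact ih h3 fun k hk hk' => h k hk (by omega)

/-- The word `x t`, with a zero inserted after the longest increasing run of subexcedents that
starts with `x`; the letter `x` is preceded by `r` positive letters. -/
def insAfter (r x : ℕ) : List ℕ → List ℕ
  | [] => [x, 0]
  | y :: t => if x < y ∧ y ≤ r + 1 then x :: insAfter (r + 1) y t else x :: 0 :: y :: t

/-- The word `u x y` for `u` the reversal of the first argument, with a zero inserted before the
longest decreasing run of subexcedents that ends with `x`. -/
def insBefore : List ℕ → ℕ → List ℕ → List ℕ
  | [], x, y => 0 :: x :: y
  | b :: u, x, y =>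
    if x < b ∧ b ≤ pos u then insBefore u b (x :: y) else (b :: u).reverse ++ 0 :: x :: y

/-- Here `s ++ [a]` is the run that the zero jumps over: `a` is subexcedent, and the last clause
says that the run cannot be prolonged. -/
theorem insAfter_decomposition (r x : ℕ) (t : List ℕ) (hx : x ≠ 0) (hr : x ≤ r) :
    ∃ s t' a, x :: t = s ++ [a] ++ t' ∧ insAfter r x t = s ++ [a] ++ 0 :: t' ∧
      (s ++ [a]).Pairwise (· < ·) ∧ (∀ y ∈ s ++ [a], x ≤ y) ∧ a ≤ r + s.length ∧
      ∀ y t'', t' = y :: t'' → ¬ (a < y ∧ y ≤ r + s.length + 1) := by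
  induction t generalizing r x with
  | nil => exact ⟨[], [], x, by simp [insAfter, hr]⟩
  | cons y t ih =>
    by_cases h : x < y ∧ y ≤ r + 1
    · obtain ⟨s, t', a, h1, h2, h3, h4, h5, h6⟩ := ih (r + 1) y (by omega) h.2
      refine ⟨x :: s, t', a, by simp [h1], by simp [insAfter, h, h2], ?_, ?_, ?_, ?_⟩
      · rw [List.cons_append, List.pairwise_cons]
        exact ⟨fun z hz => h.1.trans_le (h4 z hz), h3⟩
      · intro z hz
        rw [List.cons_append, List.mem_cons] at hz
        rcases hz with rfl | hz
        · exact le_rfl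
        · exact h.1.le.trans (h4 z hz)
      · simp; omega
      · intro z t'' hz
        have := h6 z t'' hz
        simp; omega
    · refine ⟨[], y :: t, x, by simp, by simp [insAfter, h], by simp, by simp, by simpa using hr, ?_⟩
      intro z t'' hz
      obtain ⟨rfl, rfl⟩ := List.cons.inj hz
      simpa using h

theorem insBefore_decomposition (u : List ℕ) (x : ℕ) (y : List ℕ) (hx : x ≠ 0) (hr : x ≤ pos u) :
    ∃ u' a s, u.reverse ++ [x] = u' ++ a :: s ∧ insBefore u x y = u' ++ 0 :: a :: s ++ y ∧
      (a :: s).Pairwise (· > ·) ∧ (∀ z ∈ a :: s, x ≤ z) ∧ a ≤ pos u' ∧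
      ∀ b u'', u' = u'' ++ [b] → ¬ (a < b ∧ b ≤ pos u'') := by
  induction u generalizing x y with
  -- A positive letter of rank `1` is never subexcedent.
  | nil => simp at hr; omega
  | cons b u ih =>
    by_cases h : x < b ∧ b ≤ pos u
    · obtain ⟨u', a, s, h1, h2, h3, h4, h5, h6⟩ := ih b (x :: y) (by omega) h.2
      refine ⟨u', a, s ++ [x], ?_, ?_, ?_, ?_, h5, h6⟩
      · rw [List.reverse_cons, h1]; simp
      · simp [insBefore, h, h2]
      · rw [← List.cons_append, List.pairwise_append]
        refine ⟨h3, by simp, fun z hz w hw => ?_⟩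
        rw [List.mem_singleton] at hw
        subst hw
        exact h.1.trans_le (h4 z hz)
      · intro z hz
        rw [← List.cons_append, List.mem_append, List.mem_singleton] at hz
        rcases hz with hz | rfl
        · exact h.1.le.trans (h4 z hz)
        · exact le_rfl
    · refine ⟨(b :: u).reverse, x, [], by simp, by simp [insBefore, h], by simp, by simp, ?_, ?_⟩
      · rw [pos_reverse]; exact hr
      · intro c u'' hc
        rw [List.reverse_cons] at hc
        obtain ⟨h1, h2⟩ := List.append_inj' hc rfl
        obtain rfl : b = c := by simpa using h2
        rw [← h1, pos_reverse]
        exact h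

/-- Along an increasing run the letters grow by at least one and the ranks by at most one per step.
The inequality at the end thus propagates backwards, and `incrRun` needs to test the rank only at
`k`. -/
theorem letter_lt_posRank_of_increasing {w : List ℕ} {i k : ℕ} (hik : i ≤ k)
    (h : ∀ s, i ≤ s → s < k → letter w s < letter w (s + 1)) (hk : letter w k < posRank w k) :
    letter w i < posRank w i := by
  induction k, hik using Nat.le_induction with
  | base => exact hk
  | succ k hik ih =>
    refine ih (fun s h1 h2 => h s h1 (by omega)) ?_
    have h1 := h k hik (by omega)
    have h2 : (posRank w (k + 1) : ℕ∞) ≤ posRank w k + 1 := by exact_mod_cast posRank_succ_le w k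
    have h3 := Order.add_one_le_of_lt h1
    have h4 := (h3.trans_lt hk).trans_le h2
    exact lt_of_add_lt_add_right h4

theorem letter_le_of_decreasing {w : List ℕ} {i k : ℕ} (hik : i ≤ k)
    (h : ∀ s, i ≤ s → s < k → letter w (s + 1) < letter w s) : letter w k ≤ letter w i := by
  induction k, hik using Nat.le_induction with
  | base => exact le_rfl
  | succ k hik ih =>
    exact (h k hik (by omega)).le.trans (ih fun s h1 h2 => h s h1 (by omega))

theorem shiftRight_rightEnd (u : List ℕ) (x : ℕ) (t : List ℕ) (hx : x ≠ 0) (hr : x ≤ pos u) :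
    shiftRight (u ++ 0 :: x :: t) (u.length + 1) (rightEnd (u ++ 0 :: x :: t) (u.length + 1)) =
      u ++ insAfter (pos u) x t := by
  obtain ⟨s, t', a, h1, h2, h3, h4, h5, h6⟩ := insAfter_decomposition (pos u) x t hx hr
  rw [h1, h2]
  set w := u ++ 0 :: (s ++ [a] ++ t') with hw
  have hwlen : w.length = u.length + s.length + t'.length + 2 := by simp [hw]; omega
  have hne : ∀ y ∈ s ++ [a], y ≠ 0 := fun y hy => by have := h4 y hy; omega
  have hletter : ∀ i (hi : i < (s ++ [a]).length),
      letter w (u.length + 1 + i + 1) = ((s ++ [a])[i] : ℕ∞) := by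
    intro i hi
    have := letter_append_right (u ++ [0]) (s ++ [a] ++ t') (i := i + 1) (by omega)
    rw [letter_append_left (z := s ++ [a]) (by omega) (by omega), letter_succ hi] at this
    rw [← this, hw]
    simp [add_assoc]
  have hend : rightEnd w (u.length + 1) = u.length + 1 + s.length + 1 := by
    unfold rightEnd
    rw [find?_range'_reverse_eq (i := u.length + 1 + s.length + 1)]
    · rfl
    · omega
    · omega
    · simp only [incrRun, Bool.and_eq_true, List.all_eq_true, List.mem_range'_1, decide_eq_true_eq]
      constructor
      · intro k hk
        obtain ⟨i, rfl⟩ : ∃ i, k = u.length + 1 + i + 1 := ⟨k - (u.length + 2), by omega⟩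
        have hi : i + 1 < (s ++ [a]).length := by simp; omega
        rw [hletter i (by omega), add_assoc (u.length + 1) i 1, hletter (i + 1) hi]
        exact_mod_cast List.pairwise_iff_getElem.1 h3 i (i + 1) _ hi (by omega)
      · rw [hletter s.length (by simp)]
        have : posRank w (u.length + 1 + s.length + 1) = pos u + s.length + 1 := by
          have := posRank_append (u ++ 0 :: (s ++ [a])) t'
          rw [pos_append, pos_cons, pos_eq_length hne] at this
          simp only [List.append_assoc, List.cons_append, List.length_append, List.length_cons,
            List.length_nil] at this
          rw [hw]
          simp only [List.append_assoc, List.cons_append]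
          rw [show u.length + 1 + s.length + 1 = u.length + (s.length + (0 + 1) + 1) by omega, this]
          simp; omega
        rw [this]
        simp only [List.getElem_concat_length]
        exact_mod_cast Nat.lt_succ_of_le h5
    · intro k hk hk'
      rw [← Bool.not_eq_true]
      simp only [incrRun, Bool.and_eq_true, List.all_eq_true, List.mem_range'_1, decide_eq_true_eq]
      rintro ⟨g1, g2⟩
      rcases t' with _ | ⟨y, t''⟩
      · simp at hwlen; omega
      -- A longer run would contain the letter `y` after `a`, which would then be larger than `a`
      -- and subexcedent, against the maximality in `h6`.
      · have e1 := g1 (u.length + 1 + s.length + 1) (by omega)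
        rw [hletter s.length (by simp)] at e1
        have e2 := letter_lt_posRank_of_increasing (w := w) (i := u.length + 1 + s.length + 1 + 1)
          (k := k) (by omega) (fun i hi hi' => g1 i (by omega)) g2
        have hw' : w = (u ++ 0 :: (s ++ [a])) ++ y :: t'' := by simp [hw]
        have hl : u.length + 1 + s.length + 1 + 1 = (u ++ 0 :: (s ++ [a])).length + 1 := by
          simp; omega
        rw [hl, hw', letter_append_cons] at e1 e2
        rw [posRank_append_cons, pos_append, pos_cons, pos_eq_length hne] at e2
        simp only [List.getElem_concat_length, Nat.cast_lt] at e1 e2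
        apply h6 y t'' rfl
        simp at e2
        split_ifs at e2 <;> omega
  rw [hend, shiftRight, hw]
  have e1 : u.length + 1 - 1 = u.length := by omega
  have e2 : u.length + 1 + s.length + 1 - (u.length + 1) = (s ++ [a]).length := by simp; omega
  have e3 : u ++ 0 :: (s ++ [a] ++ t') = (u ++ [0]) ++ (s ++ [a] ++ t') := by simp
  have e4 : u ++ 0 :: (s ++ [a] ++ t') = (u ++ 0 :: (s ++ [a])) ++ t' := by simp
  have e5 : List.drop (u.length + 1 + s.length + 1) (u ++ 0 :: (s ++ [a] ++ t')) = t' := by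
    rw [e4, show u.length + 1 + s.length + 1 = (u ++ 0 :: (s ++ [a])).length by simp; omega,
      List.drop_left]
  have e6 : List.drop (u.length + 1) (u ++ 0 :: (s ++ [a] ++ t')) = s ++ [a] ++ t' := by
    rw [e3, show u.length + 1 = (u ++ [0]).length by simp, List.drop_left]
  rw [e1, e2, e5, e6, List.take_left, List.take_left, List.append_assoc]

theorem shiftLeft_leftEnd (u : List ℕ) (x : ℕ) (y : List ℕ) (hx : x ≠ 0) (hr : x ≤ pos u) :
    shiftLeft (u ++ x :: 0 :: y) (leftEnd (u ++ x :: 0 :: y) (u.length + 2)) (u.length + 2) =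
      insBefore u.reverse x y := by
  obtain ⟨u', a, s, h1, h2, h3, h4, h5, h6⟩ :=
    insBefore_decomposition u.reverse x y hx (by rwa [pos_reverse])
  rw [h2]
  rw [List.reverse_reverse] at h1
  have hlen : u.length + 1 = u'.length + s.length + 1 := by
    simpa [add_assoc] using congrArg List.length h1
  have hu : u ++ x :: 0 :: y = u' ++ (a :: s ++ 0 :: y) := by
    rw [← List.singleton_append (x := x), ← List.append_assoc, h1]; simp
  rw [hu]
  set w := u' ++ (a :: s ++ 0 :: y) with hw
  have hletter : ∀ i (hi : i < (a :: s).length),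
      letter w (u'.length + i + 1) = ((a :: s)[i] : ℕ∞) := by
    intro i hi
    have := letter_append_right u' (a :: s ++ 0 :: y) (i := i + 1) (by omega)
    rw [letter_append_left (z := a :: s) (by omega) (by omega), letter_succ hi] at this
    rw [← this, hw]
    rfl
  have hend : leftEnd w (u.length + 2) = u'.length + 1 := by
    unfold leftEnd
    rw [find?_range'_eq (i := u'.length + 1)]
    · rfl
    · omega
    · omega
    · simp only [decrRun, Bool.and_eq_true, List.all_eq_true, List.mem_range'_1, decide_eq_true_eq]
      constructor
      · have ha : a ≠ 0 := by have := h4 a (by simp); omega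
        rw [hw, List.cons_append, letter_append_cons, posRank_append_cons, if_neg ha]
        exact_mod_cast Nat.lt_succ_of_le h5
      · intro k hk
        obtain ⟨i, rfl⟩ : ∃ i, k = u'.length + i + 1 := ⟨k - (u'.length + 1), by omega⟩
        have hi : i + 1 < (a :: s).length := by simp; omega
        rw [hletter i (by omega), add_assoc u'.length i 1, hletter (i + 1) hi]
        exact_mod_cast List.pairwise_iff_getElem.1 h3 i (i + 1) _ hi (by omega)
    · intro k hk hk'
      rw [← Bool.not_eq_true]
      simp only [decrRun, Bool.and_eq_true, List.all_eq_true, List.mem_range'_1, decide_eq_true_eq]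
      rintro ⟨g1, g2⟩
      rcases List.eq_nil_or_concat u' with rfl | ⟨u'', b, rfl⟩
      · simp at hk'; omega
      · rw [List.concat_eq_append] at *
        rw [List.length_append, List.length_singleton] at *
        -- A run starting further left contains the letter `b` before `a`. Letters decrease and
        -- ranks do not, so `b` would be subexcedent and larger than `a`, against `h6`.
        have e1 := g2 (u''.length + 1) (by omega)
        have e2 := letter_le_of_decreasing (w := w) (i := k) (k := u''.length + 1) (by omega)
          (fun i hi hi' => g2 i (by omega))
        have e3 : (posRank w k : ℕ∞) ≤ posRank w (u''.length + 1) := by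
          exact_mod_cast posRank_mono w (by omega)
        have e4 := (e2.trans_lt g1).trans_le e3
        have e5 := hletter 0 (by simp)
        rw [add_zero] at e5
        rw [e5, hw, List.append_assoc, List.singleton_append, letter_append_cons] at e1
        rw [hw, List.append_assoc, List.singleton_append, letter_append_cons,
          posRank_append_cons] at e4
        simp only [List.getElem_cons_zero, Nat.cast_lt] at e1 e4
        apply h6 b u'' rfl
        rw [if_neg (by omega)] at e4
        omega
  rw [hend, shiftLeft]
  have e2 : u.length + 2 - (u'.length + 1) = (a :: s).length := by simp; omega
  have e4 : w = (u' ++ (a :: s ++ [0])) ++ y := by simp [hw]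
  rw [Nat.add_sub_cancel, e2]
  have e5 : List.drop (u.length + 2) w = y := by
    rw [e4, show u.length + 2 = (u' ++ (a :: s ++ [0])).length by simp; omega, List.drop_left]
  rw [e5, hw, List.take_left, List.drop_left, List.take_left]

theorem phi_append (u y : List ℕ) :
    phi (u.count 0 + 1) (u ++ 0 :: y) =
      if movesRight (u ++ 0 :: y) (u.length + 1) then
        shiftRight (u ++ 0 :: y) (u.length + 1) (rightEnd (u ++ 0 :: y) (u.length + 1))
      else if movesLeft (u ++ 0 :: y) (u.length + 1) then
        shiftLeft (u ++ 0 :: y) (leftEnd (u ++ 0 :: y) (u.length + 1)) (u.length + 1)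
      else u ++ 0 :: y := by
  have h : (zeroPos (u ++ 0 :: y))[u.count 0 + 1 - 1]? = some (u.length + 1) := by
    rw [zeroPos_append, Nat.add_sub_cancel, List.getElem?_append_right (by rw [length_zeroPos]),
      length_zeroPos, Nat.sub_self]
    have : zeroPos (0 :: y) = 1 :: (zeroPos y).map (· + 1) := zeroPos_append [0] y
    rw [this]
    simp [add_comm]
  rw [phi, h]

/-- The last letter of `u` is subexcedent. -/
def LastSub (u : List ℕ) : Prop := ∃ u' a, u = u' ++ [a] ∧ a ≠ 0 ∧ a ≤ pos u'

/-- The first letter of `y` is subexcedent, when preceded by `r` positive letters. -/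
def HeadSub (r : ℕ) (y : List ℕ) : Prop := ∃ x t, y = x :: t ∧ x ≠ 0 ∧ x ≤ r

theorem subexc_left_iff (u y : List ℕ) :
    subexc (u ++ 0 :: y) (u.length + 1 - 1) = true ↔ LastSub u := by
  rcases List.eq_nil_or_concat u with rfl | ⟨u, b, rfl⟩
  · simp [subexc_zero, LastSub]
  · rw [List.concat_eq_append]
    have := subexc_append_cons u b (0 :: y)
    rw [Nat.add_sub_cancel, List.length_append, List.length_singleton, List.append_assoc,
      List.singleton_append, this, decide_eq_true_iff]
    constructor
    · intro h; exact ⟨u, b, rfl, h⟩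
    · rintro ⟨u', a, h1, h2⟩
      obtain ⟨rfl, h4⟩ := List.append_inj' h1 rfl
      obtain rfl : b = a := by simpa using h4
      exact h2

theorem subexc_right_iff (u y : List ℕ) :
    subexc (u ++ 0 :: y) (u.length + 1 + 1) = true ↔ HeadSub (pos u) y := by
  cases y with
  | nil =>
    rw [subexc_of_length_lt (by simp)]
    simp [HeadSub]
  | cons x t =>
    have := subexc_append_cons (u ++ [0]) x t
    simp only [List.append_assoc, List.singleton_append, List.length_append,
      List.length_singleton] at this
    rw [this, decide_eq_true_iff]
    simp [HeadSub]

theorem phi_stay {u y : List ℕ} (hL : ¬ LastSub u) (hR : ¬ HeadSub (pos u) y) :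
    phi (u.count 0 + 1) (u ++ 0 :: y) = u ++ 0 :: y := by
  rw [← subexc_left_iff u y, Bool.not_eq_true] at hL
  rw [← subexc_right_iff u y, Bool.not_eq_true] at hR
  rw [phi_append, movesRight, movesLeft, hL, hR]
  simp

theorem phi_right {u t : List ℕ} {x : ℕ} (hx : x ≠ 0) (hr : x ≤ pos u)
    (hL : ∀ u' a, u = u' ++ [a] → a ≠ 0 → a ≤ pos u' → x < a) :
    phi (u.count 0 + 1) (u ++ 0 :: x :: t) = u ++ insAfter (pos u) x t := by
  rw [phi_append, if_pos, shiftRight_rightEnd u x t hx hr]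
  have hR : subexc (u ++ 0 :: x :: t) (u.length + 1 + 1) = true :=
    (subexc_right_iff ..).2 ⟨x, t, rfl, hx, hr⟩
  rw [movesRight, hR, Bool.true_and, Bool.or_eq_true, decide_eq_true_eq, Bool.not_eq_true']
  by_cases h : LastSub u
  · obtain ⟨u', a, rfl, ha, ha'⟩ := h
    right
    have h1 := letter_append_cons (u' ++ [a] ++ [0]) x t
    have h2 := letter_append_cons u' a (0 :: x :: t)
    simp only [List.append_assoc, List.length_append, List.length_cons,
      List.length_nil, List.cons_append, List.nil_append] at h1 h2 ⊢
    rw [show u'.length + (0 + 1) + 1 - 1 = u'.length + 1 by omega, h2,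
      show u'.length + (0 + 1) + 1 + 1 = u'.length + (0 + 1 + 1) + 1 by omega, h1]
    exact_mod_cast hL u' a rfl ha ha'
  · left
    rwa [← subexc_left_iff u (x :: t), Bool.not_eq_true] at h

theorem phi_left {u y : List ℕ} {a : ℕ} (ha : a ≠ 0) (hr : a ≤ pos u)
    (hR : ∀ x t, y = x :: t → x ≠ 0 → x ≤ pos u + 1 → a < x) :
    phi ((u ++ [a]).count 0 + 1) (u ++ [a] ++ 0 :: y) = insBefore u.reverse a y := by
  have hpos : pos (u ++ [a]) = pos u + 1 := by simp [ha]
  have hL : subexc (u ++ [a] ++ 0 :: y) ((u ++ [a]).length + 1 - 1) = true :=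
    (subexc_left_iff ..).2 ⟨u, a, rfl, ha, hr⟩
  have hlen : (u ++ [a]).length + 1 = u.length + 2 := by simp
  have key : subexc (u ++ [a] ++ 0 :: y) ((u ++ [a]).length + 1 + 1) = true →
      letter (u ++ [a] ++ 0 :: y) ((u ++ [a]).length + 1 - 1) <
        letter (u ++ [a] ++ 0 :: y) ((u ++ [a]).length + 1 + 1) := by
    intro h
    rw [subexc_right_iff, hpos] at h
    obtain ⟨x, t, rfl, hx, hx'⟩ := h
    have h1 := letter_append_cons (u ++ [a] ++ [0]) x t
    have h2 := letter_append_cons u a (0 :: x :: t)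
    simp only [List.append_assoc, List.length_append, List.length_cons,
      List.length_nil, List.cons_append, List.nil_append] at h1 h2 ⊢
    rw [show u.length + (0 + 1) + 1 - 1 = u.length + 1 by omega, h2,
      show u.length + (0 + 1) + 1 + 1 = u.length + (0 + 1 + 1) + 1 by omega, h1]
    exact_mod_cast hR x t rfl hx hx'
  rw [phi_append, if_neg, if_pos, hlen]
  · have := shiftLeft_leftEnd u a y ha hr
    simpa using this
  · rw [movesLeft, hL, Bool.true_and, Bool.or_eq_true, decide_eq_true_eq, Bool.not_eq_true']
    by_cases h : subexc (u ++ [a] ++ 0 :: y) ((u ++ [a]).length + 1 + 1) = true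
    · exact Or.inr (key h)
    · exact Or.inl (by simpa using h)
  · rw [movesRight, hL]
    intro h
    simp only [Bool.not_true, Bool.false_or, Bool.and_eq_true, decide_eq_true_eq] at h
    exact lt_asymm (key h.1) h.2

/-! ### `Φ` in terms of slot contents -/

/-- The composition `φ_1 ⋯ φ_k`. -/
def phiTo (k : ℕ) (w : List ℕ) : List ℕ := (List.range' 1 k).foldr phi w

theorem phiTo_zero (w : List ℕ) : phiTo 0 w = w := rfl

theorem phiTo_succ (k : ℕ) (w : List ℕ) : phiTo (k + 1) w = phiTo k (phi (k + 1) w) := by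
  unfold phiTo
  rw [List.range'_concat, List.foldr_append]
  simp [add_comm]

theorem phi_of_count_lt {l : ℕ} {w : List ℕ} (h : w.count 0 < l) : phi l w = w := by
  unfold phi
  rw [List.getElem?_eq_none]
  rw [length_zeroPos]
  omega

theorem phiTo_count_add (w : List ℕ) (k : ℕ) : phiTo (w.count 0 + k) w = phiTo (w.count 0) w := by
  induction k with
  | zero => rfl
  | succ k ih => rw [← add_assoc, phiTo_succ, phi_of_count_lt (by omega), ih]

/-- The factors `phi l` with `l` beyond the number of zeros act trivially. This frees `Phi` from the
length of the word and permits induction over prefixes. -/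
theorem Phi_eq_phiTo (w : List ℕ) : Phi w = phiTo (w.count 0) w := by
  have h : w.count 0 ≤ w.length := List.count_le_length
  rw [← phiTo_count_add w (w.length - w.count 0), Nat.add_sub_cancel' h]
  rfl

/-- Insertion of a zero after the longest increasing run of subexcedents at the beginning. -/
def ins (r : ℕ) : List ℕ → List ℕ
  | [] => [0]
  | x :: t => insAfter r x t

theorem exists_insAfter_eq_cons (r x : ℕ) (t : List ℕ) : ∃ t', insAfter r x t = x :: t' := by
  cases t with
  | nil => exact ⟨_, rfl⟩
  | cons y t =>
    rw [insAfter]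
    split_ifs
    · exact ⟨_, rfl⟩
    · exact ⟨_, rfl⟩

theorem exists_ins_iterate_eq_cons (r x : ℕ) (t : List ℕ) (e : ℕ) :
    ∃ t', (ins r)^[e] (x :: t) = x :: t' := by
  induction e with
  | zero => exact ⟨t, rfl⟩
  | succ e ih =>
    obtain ⟨t', h⟩ := ih
    rw [Function.iterate_succ_apply', h]
    exact exists_insAfter_eq_cons r x t'

/-- Insertions never displace the first letter `x`, so the run through `b` continues into `x` each
time. -/
theorem ins_iterate_cons_of_lt {r b x : ℕ} (h : b < x) (h' : x ≤ r + 1) (t : List ℕ) (e : ℕ) :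
    (ins r)^[e] (b :: x :: t) = b :: (ins (r + 1))^[e] (x :: t) := by
  induction e with
  | zero => rfl
  | succ e ih =>
    rw [Function.iterate_succ_apply', Function.iterate_succ_apply', ih]
    obtain ⟨t', ht⟩ := exists_ins_iterate_eq_cons (r + 1) x t e
    rw [ht, ins, insAfter, if_pos ⟨h, h'⟩]
    rfl

/-- The run stops at `b`: for the first zero by hypothesis, for the later ones because a zero now
follows `b`. The zeros pile up behind `b`. -/
theorem ins_iterate_cons {r b : ℕ} {y : List ℕ}
    (h : ∀ x t, y = x :: t → ¬ (b < x ∧ x ≤ r + 1)) (e : ℕ) :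
    (ins r)^[e] (b :: y) = b :: (List.replicate e 0 ++ y) := by
  induction e with
  | zero => rfl
  | succ e ih =>
    rw [Function.iterate_succ_apply', ih]
    cases e with
    | succ e => simp [ins, insAfter, List.replicate_succ]
    | zero =>
      cases y with
      | nil => rfl
      | cons x t => simp [ins, insAfter, h x t rfl]

theorem not_lastSub_append_zero (u : List ℕ) : ¬ LastSub (u ++ [0]) := by
  rintro ⟨u', a, h1, h2, -⟩
  exact h2 (by simpa using (List.append_inj' h1 rfl).2.symm)

theorem append_replicate_succ (u y : List ℕ) (k : ℕ) :
    u ++ List.replicate (k + 1) 0 ++ y = u ++ List.replicate k 0 ++ 0 :: y := by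
  rw [List.replicate_succ']
  simp

theorem count_append_replicate (u : List ℕ) (k : ℕ) :
    (u ++ List.replicate k 0).count 0 = u.count 0 + k := by
  simp

theorem pos_append_replicate (u : List ℕ) (k : ℕ) : pos (u ++ List.replicate k 0) = pos u := by
  simp [pos_replicate_zero]

theorem phiTo_zeros_stay {u y : List ℕ} (hL : ¬ LastSub u) (hR : ¬ HeadSub (pos u) y) (k : ℕ) :
    phiTo (u.count 0 + k) (u ++ List.replicate k 0 ++ y) =
      phiTo (u.count 0) (u ++ List.replicate k 0 ++ y) := by
  induction k generalizing y with
  | zero => rfl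
  | succ k ih =>
    rw [append_replicate_succ, ← add_assoc, phiTo_succ, ← count_append_replicate, phi_stay]
    · rw [count_append_replicate]
      apply ih
      rintro ⟨x, t, h1, h2, -⟩
      obtain ⟨rfl, -⟩ := List.cons.inj h1
      exact h2 rfl
    · cases k with
      | zero => simpa using hL
      | succ k =>
        rw [List.replicate_succ', ← List.append_assoc]
        exact not_lastSub_append_zero _
    · rwa [pos_append_replicate]

/-- The zeros are treated from right to left. Each finds the same letter `x` on its right, and only
the leftmost has the end of `u` on its left; the others have a zero there, which is non-subexcedent.
-/
theorem phiTo_zeros_right {u t : List ℕ} {x : ℕ} (hx : x ≠ 0) (hr : x ≤ pos u)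
    (hL : ∀ u' a, u = u' ++ [a] → a ≠ 0 → a ≤ pos u' → x < a) (k : ℕ) :
    phiTo (u.count 0 + k) (u ++ List.replicate k 0 ++ x :: t) =
      phiTo (u.count 0) (u ++ (ins (pos u))^[k] (x :: t)) := by
  induction k generalizing t with
  | zero => simp
  | succ k ih =>
    rw [append_replicate_succ, ← add_assoc, phiTo_succ, ← count_append_replicate, phi_right hx]
    · rw [count_append_replicate, pos_append_replicate, Function.iterate_succ_apply, ins]
      obtain ⟨t', h⟩ := exists_insAfter_eq_cons (pos u) x t
      rw [h, ih]
    · rwa [pos_append_replicate]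
    · cases k with
      | zero => simpa using hL
      | succ k =>
        intro u' a h1 h2
        rw [List.replicate_succ', ← List.append_assoc] at h1
        exact absurd (by simpa using (List.append_inj' h1 rfl).2.symm) h2

/-- The letter at the position `j + 1` of a word `v` with positive letters is subexcedent. -/
def sub (v : List ℕ) (j : ℕ) : Bool :=
  decide (j < v.length ∧ v.getD j 0 ≤ j)

/-- Colours of the slots of `v` with respect to the insertion of a fixed point. -/
def fixGreen (v : List ℕ) (j : ℕ) : Bool :=
  decide (j = 0) ||
    if sub v (j - 1) then !sub v j || decide (v.getD j 0 < v.getD (j - 1) 0)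
    else !sub v j && decide (j < v.length) && decide (v.getD j 0 < v.getD (j - 1) 0)

section

variable (p : List ℕ) (a x : ℕ) (q : List ℕ)

theorem sub_append_cons : sub (p ++ a :: q) p.length = decide (a ≤ p.length) := by
  simp [sub]

theorem sub_append_cons_cons :
    sub (p ++ a :: x :: q) (p.length + 1) = decide (x ≤ p.length + 1) := by
  have := sub_append_cons (p ++ [a]) x q
  simpa using this

theorem sub_concat : sub (p ++ [a]) (p.length + 1) = false := by
  simp [sub]

theorem zeroGreen_append_cons_cons :
    zeroGreen (p ++ a :: x :: q) (p.length + 1) = decide (x < a) := by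
  simp [zeroGreen, List.getD_eq_getElem?_getD]

theorem zeroGreen_concat : zeroGreen (p ++ [a]) (p.length + 1) = false := by
  simp [zeroGreen]

/-- Comparison with `zeroGreen`: if `a` and `x` are both subexcedent or both not, each colour is
decided by `x < a`. The colourings differ exactly when one of the two letters is subexcedent, and
there `Phi` has to compensate. -/
theorem fixGreen_append_cons_cons :
    fixGreen (p ++ a :: x :: q) (p.length + 1) =
      if a ≤ p.length then decide (¬ x ≤ p.length + 1 ∨ x < a)
      else decide (¬ x ≤ p.length + 1 ∧ x < a) := by
  unfold fixGreen
  rw [sub_append_cons_cons, Nat.add_sub_cancel, sub_append_cons]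
  by_cases h : a ≤ p.length <;> by_cases h2 : x ≤ p.length + 1 <;>
    simp [h, h2, List.getD_eq_getElem?_getD]

theorem fixGreen_concat : fixGreen (p ++ [a]) (p.length + 1) = decide (a ≤ p.length) := by
  unfold fixGreen
  rw [sub_concat, Nat.add_sub_cancel, sub_append_cons]
  by_cases h : a ≤ p.length <;> simp [h]

end

/-- Stage `j` has not yet read slot `j`, so the content of a new last slot can be prescribed
afterwards. -/
theorem evolve_update (χ : ℕ → Bool) (c : ℕ → ℕ) (j k : ℕ) :
    evolve χ (Function.update c j k) j = evolve χ c j :=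
  evolve_congr (fun _ _ => rfl) fun i hi => by rw [Function.update_of_ne (by omega)]

theorem place_update (p : List ℕ) (a : ℕ) (c : ℕ → ℕ) (k : ℕ) :
    place (p ++ [a]) (Function.update c (p.length + 1) k) =
      place p c ++ a :: List.replicate k 0 := by
  rw [place_snoc, Function.update_self, place_congr (d := c)]
  intro i hi
  rw [Function.update_of_ne (by omega)]

theorem pos_place {v : List ℕ} (hv : ∀ x ∈ v, x ≠ 0) (c : ℕ → ℕ) : pos (place v c) = v.length := by
  conv_rhs => rw [← filter_place hv c]
  rw [pos, List.countP_eq_length_filter]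

/-- Induction on the prefix `p`, following the traffic of zeros across its right end. If no
subexcedent letter follows, nothing crosses. If the next letter `x` is subexcedent, either `e` zeros
leave to the right, recorded by `push e`, or one zero arriving from the right of `x` enters,
recorded by an additional `1` at the index of the last slot. A moving zero never overtakes another
zero, so the zeros still to be treated keep their numbers. The three clauses feed each other: what
crosses the end of `p ++ [a]` depends on whether `a` and `x` are subexcedent, on their order, and on
what crosses the end of `p`. -/
theorem exists_phiTo_place {v : List ℕ} (hv : ∀ x ∈ v, x ≠ 0) (hnd : v.Nodup) (c : ℕ → ℕ)
    (p q : List ℕ) (hpq : v = p ++ q) :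
    (∀ y, sub v p.length = false → ¬ HeadSub p.length y →
      ∃ c', phiTo ((place p c).count 0) (place p c ++ y) = place p c' ++ y ∧
        evolve (zeroGreen v) c (p.length + 1) = evolve (fixGreen v) c' (p.length + 1)) ∧
    (∀ x t q', q = x :: q' → x ≤ p.length →
      ∃ c' e, phiTo ((place p c).count 0) (place p c ++ x :: t) =
          place p c' ++ (ins p.length)^[e] (x :: t) ∧
        evolve (zeroGreen v) c (p.length + 1) =
          push e (evolve (fixGreen v) c' (p.length + 1))) ∧
    (∀ x t q', q = x :: q' → x ≤ p.length →
      ∃ c', phiTo ((place p c).count 0) (insBefore (place p c).reverse x t) =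
          place p c' ++ x :: t ∧
        evolve (fixGreen v) c' (p.length + 1) =
          evolve (zeroGreen v) c (p.length + 1) + Pi.single p.length 1) := by
  induction p using List.reverseRecOn generalizing q with
  | nil =>
    subst hpq
    refine ⟨fun y _ hy => ⟨c, ?_, ?_⟩, ?_, ?_⟩
    · have := phiTo_zeros_stay (u := []) (y := y) (by rintro ⟨u', a, h, -⟩; simp at h) hy (c 0)
      simpa [place, phiTo_zero] using this
    · simp [evolve, zeroGreen, fixGreen]
    · rintro x t q' rfl h
      -- The first letter of `v` is not subexcedent, so no zero crosses the end of slot `0`.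
      exact absurd (Nat.le_zero.1 h) (hv x (by simp))
    · rintro x t q' rfl h
      exact absurd (Nat.le_zero.1 h) (hv x (by simp))
  | append_singleton p a ih =>
    obtain ⟨ihN, ihA, ihB⟩ := ih (a :: q) (by simp [hpq])
    replace hpq : v = p ++ a :: q := by simp [hpq]
    have hlen : (p ++ [a]).length = p.length + 1 := by simp
    have ha : a ≠ 0 := hv a (by simp [hpq])
    have hp : ∀ x ∈ p, x ≠ 0 := fun x hx => hv x (by simp [hpq, hx])
    have hposp : pos (place p c) = p.length := pos_place hp c
    have hpos : pos (place p c ++ [a]) = p.length + 1 := by simp [ha, hposp]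
    have hcnt : (place p c ++ [a]).count 0 = (place p c).count 0 := by simp [ha]
    have hcnt' : ∀ k, (place p c ++ [a] ++ List.replicate k 0).count 0 = (place p c).count 0 + k :=
      fun k => by rw [count_append_replicate, hcnt]
    have hsuba : sub v p.length = decide (a ≤ p.length) := by rw [hpq, sub_append_cons]
    have hlast : a ≤ p.length ∨ ¬ LastSub (place p c ++ [a]) := by
      rcases Nat.lt_or_ge p.length a with h | h
      · right
        rintro ⟨u', b, h1, -, h2⟩
        obtain ⟨rfl, h3⟩ := List.append_inj' h1 rfl
        obtain rfl : a = b := by simpa using h3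
        omega
      · exact Or.inl h
    have hheada : p.length < a → ∀ y, ¬ HeadSub p.length (a :: y) := by
      rintro h y ⟨x, t, h1, -, h2⟩
      obtain ⟨rfl, -⟩ := List.cons.inj h1
      omega
    have hplace : place (p ++ [a]) c =
        place p c ++ [a] ++ List.replicate (c (p.length + 1)) 0 := by
      rw [place_snoc]; simp
    simp only [hlen]
    rw [hplace, hcnt']
    set s := p.length + 1 with hs
    -- The zeros of the slot, except the first, stay; the first one moves to the left
    have leftStay : a ≤ p.length → ∀ y k, ¬ HeadSub s y →
        phiTo ((place p c).count 0 + (k + 1)) (place p c ++ [a] ++ List.replicate (k + 1) 0 ++ y) =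
          phiTo ((place p c).count 0)
            (insBefore (place p c).reverse a (List.replicate k 0 ++ y)) := by
      intro h y k hy
      have h1 := phiTo_zeros_stay (u := place p c ++ [a] ++ [0]) (y := y)
        (not_lastSub_append_zero _) (by simpa [ha, hposp, ← hs] using hy) k
      have h2 := phi_left (u := place p c) (a := a) (y := List.replicate k 0 ++ y) ha
        (by rw [hposp]; exact h) (by
          intro x t h3 h4 h5
          exfalso
          cases k with
          | zero => exact hy ⟨x, t, by simpa using h3, h4, by rw [hposp] at h5; exact h5⟩
          | succ k =>
            rw [List.replicate_succ, List.cons_append] at h3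
            exact h4 (List.cons.inj h3).1.symm)
      rw [List.count_append, hcnt, List.count_singleton_self] at h1
      rw [hcnt] at h2
      have h3 : place p c ++ [a] ++ List.replicate (k + 1) 0 ++ y =
          place p c ++ [a] ++ [0] ++ List.replicate k 0 ++ y := by
        rw [List.replicate_succ]; simp
      rw [h3, show (place p c).count 0 + (k + 1) = (place p c).count 0 + 1 + k by omega, h1,
        phiTo_succ, ← h2]
      simp
    refine ⟨?_, ?_, ?_⟩
    · intro y hsub hy
      -- If `a` is not subexcedent either, the zeros of the slot stay and the two colours agree.
      -- Otherwise the slot is red for zeros and green for fixed points: if occupied it sends its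
      -- leftmost zero to the left, and if empty it receives the `e` zeros that cross `a`.
      rcases Nat.lt_or_ge p.length a with h | h
      · rw [← hcnt, phiTo_zeros_stay (hlast.resolve_left (by omega)) (by rwa [hpos]), hcnt]
        obtain ⟨c', h1, h2⟩ := ihN (a :: (List.replicate (c s) 0 ++ y))
          (by rw [hsuba]; simpa using h) (hheada h _)
        refine ⟨Function.update c' s (c s), ?_, ?_⟩
        · rw [place_update]
          simpa using h1
        · have hcol : zeroGreen v s = fixGreen v s := by
            cases q with
            | nil => rw [hpq, hs, zeroGreen_concat, fixGreen_concat]; simpa using h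
            | cons x q =>
              rw [hpq, hs, sub_append_cons_cons] at hsub
              rw [hpq, hs, zeroGreen_append_cons_cons, fixGreen_append_cons_cons, if_neg (by omega)]
              simp only [decide_eq_false_iff_not] at hsub
              simp [hsub]
          simp only [evolve, hcol, Function.update_self, evolve_update, h2]
      · have hred : zeroGreen v s = false := by
          cases q with
          | nil => rw [hpq, hs, zeroGreen_concat]
          | cons x q =>
            rw [hpq, hs, sub_append_cons_cons] at hsub
            rw [hpq, hs, zeroGreen_append_cons_cons]
            simp only [decide_eq_false_iff_not] at hsub ⊢
            omega
        have hgreen : fixGreen v s = true := by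
          cases q with
          | nil => rw [hpq, hs, fixGreen_concat]; simpa using h
          | cons x q =>
            rw [hpq, hs, sub_append_cons_cons] at hsub
            rw [hpq, hs, fixGreen_append_cons_cons, if_pos h]
            simp only [decide_eq_false_iff_not] at hsub
            simp [hsub]
        rcases hc : c s with _ | k
        · obtain ⟨c', e, h1, h2⟩ := ihA a y q rfl h
          refine ⟨Function.update c' s e, ?_, ?_⟩
          · rw [place_update]
            rw [ins_iterate_cons] at h1
            · simpa using h1
            · rintro x t rfl ⟨h3, h4⟩
              exact hy ⟨x, t, rfl, by omega, h4⟩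
          · rw [evolve_succ_red_zero hred hc, evolve_succ_green hgreen, Function.update_self,
              evolve_update, h2]
        · obtain ⟨c', h1, h2⟩ := ihB a (List.replicate k 0 ++ y) q rfl h
          refine ⟨Function.update c' s k, ?_, ?_⟩
          · rw [leftStay h y k hy, h1, place_update]
            simp
          · rw [evolve_succ_red hred hc, evolve_succ_green hgreen, Function.update_self,
              evolve_update, h2, push_add_single]
    · rintro x t q' rfl hx
      have hx0 : x ≠ 0 := hv x (by simp [hpq])
      have hax : a ≠ x := by
        rintro rfl
        rw [hpq] at hnd
        simp [List.nodup_append] at hnd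
      have hzg : zeroGreen v s = decide (x < a) := by
        rw [hpq, hs, zeroGreen_append_cons_cons]
      have hfg : fixGreen v s = if a ≤ p.length then decide (x < a) else false := by
        rw [hpq, hs, fixGreen_append_cons_cons]
        simp [hs ▸ hx]
      have right : (x < a) → ∀ k, phiTo ((place p c).count 0 + k)
          (place p c ++ [a] ++ List.replicate k 0 ++ x :: t) =
            phiTo ((place p c).count 0) (place p c ++ [a] ++ (ins s)^[k] (x :: t)) := by
        intro h k
        have := phiTo_zeros_right (u := place p c ++ [a]) (t := t) hx0 (by rw [hpos]; exact hx)
          (by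
            intro u' b h1 _ _
            obtain rfl : a = b := by simpa using (List.append_inj' h1 rfl).2
            exact h) k
        rwa [hcnt, hpos] at this
      rcases Nat.lt_or_ge p.length a with h | h
      -- Here `a ≥ s ≥ x` and `a ≠ x`. The slot is green for zeros and red for fixed points; all its
      -- zeros go right and it is left empty.
      · have hxa : x < a := by omega
        rw [right hxa]
        obtain ⟨c', h1, h2⟩ := ihN (a :: (ins s)^[c s] (x :: t))
          (by rw [hsuba]; simpa using h) (hheada h _)
        refine ⟨Function.update c' s 0, c s, ?_, ?_⟩
        · rw [place_update]
          simpa using h1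
        · rw [evolve_succ_green (χ := zeroGreen v) (by rw [hzg]; simpa using hxa),
            evolve_succ_red_zero (χ := fixGreen v) (by rw [hfg, if_neg (by omega)]) (by simp),
            evolve_update, h2]
      · rw [if_pos h] at hfg
        rcases Nat.lt_or_gt_of_ne hax with hax | hax
        · have hred : decide (x < a) = false := by simpa using hax.le
          rw [hred] at hzg hfg
          rcases hc : c s with _ | k
          · obtain ⟨c', e, h1, h2⟩ := ihA a (x :: t) (x :: q') rfl h
            refine ⟨Function.update c' s 0, e, ?_, ?_⟩
            · rw [place_update]
              rw [ins_iterate_cons_of_lt hax hx] at h1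
              simpa using h1
            · rw [evolve_succ_red_zero hzg hc, evolve_succ_red_zero hfg (by simp), evolve_update, h2]
          -- Of the `k + 1` zeros, the last `k` see a zero on their left and move right past `x`;
          -- the first one then sees `a < x` and moves left.
          · obtain ⟨c', h1, h2⟩ := ihB a ((ins s)^[k] (x :: t)) (x :: q') rfl h
            refine ⟨Function.update c' s 0, k, ?_, ?_⟩
            · rw [place_update]
              have e1 := phiTo_zeros_right (u := place p c ++ [a] ++ [0]) (t := t) hx0
                (by simpa [ha, hposp, ← hs] using hx)
                (by
                  intro u' b h1 h2 _
                  exact absurd (by simpa using (List.append_inj' h1 rfl).2.symm) h2) k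
              have e0 : pos (place p c ++ [a] ++ [0]) = s := by simp [ha, hposp, hs]
              rw [e0, List.count_append, hcnt, List.count_singleton_self] at e1
              have e2 := phi_left (u := place p c) (a := a) (y := (ins s)^[k] (x :: t)) ha
                (by rw [hposp]; exact h) (by
                  intro x' t' h3 _ _
                  obtain ⟨t'', h4⟩ := exists_ins_iterate_eq_cons s x t k
                  rw [h4] at h3
                  obtain ⟨rfl, -⟩ := List.cons.inj h3
                  exact hax)
              rw [hcnt] at e2
              have e3 : place p c ++ [a] ++ List.replicate (k + 1) 0 ++ x :: t =
                  place p c ++ [a] ++ [0] ++ List.replicate k 0 ++ x :: t := by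
                rw [List.replicate_succ]; simp
              rw [e3, show (place p c).count 0 + (k + 1) = (place p c).count 0 + 1 + k by omega, e1,
                phiTo_succ]
              have e4 : place p c ++ [a] ++ [0] ++ (ins s)^[k] (x :: t) =
                  place p c ++ [a] ++ 0 :: (ins s)^[k] (x :: t) := by simp
              rw [e4, e2, h1]
              simp
            · rw [evolve_succ_red hzg hc, evolve_succ_red_zero hfg (by simp), evolve_update, h2,
                push_add_single]
        · have hgreen : decide (x < a) = true := by simpa using hax
          rw [hgreen] at hzg hfg
          rw [right hax]
          -- The `c s` zeros of the slot leave to the right. The `e` zeros coming across `a` stop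
          -- behind it since `x < a`, and refill the slot.
          obtain ⟨c', e, h1, h2⟩ := ihA a ((ins s)^[c s] (x :: t)) (x :: q') rfl h
          refine ⟨Function.update c' s e, c s, ?_, ?_⟩
          · rw [place_update]
            rw [ins_iterate_cons (y := (ins s)^[c s] (x :: t))] at h1
            · simpa using h1
            · intro x' t' h3 h4
              obtain ⟨t'', h5⟩ := exists_ins_iterate_eq_cons s x t (c s)
              rw [h5] at h3
              obtain ⟨rfl, -⟩ := List.cons.inj h3
              omega
          · rw [evolve_succ_green hzg, evolve_succ_green hfg, Function.update_self, evolve_update, h2]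
    · rintro x t q' rfl hx
      have hx0 : x ≠ 0 := hv x (by simp [hpq])
      have hax : a ≠ x := by
        rintro rfl
        rw [hpq] at hnd
        simp [List.nodup_append] at hnd
      have hzg : zeroGreen v s = decide (x < a) := by
        rw [hpq, hs, zeroGreen_append_cons_cons]
      have hfg : fixGreen v s = if a ≤ p.length then decide (x < a) else false := by
        rw [hpq, hs, fixGreen_append_cons_cons]
        simp [hs ▸ hx]
      have hz : ¬ HeadSub s (0 :: x :: t) := by
        rintro ⟨y, t', h1, h2, -⟩
        exact h2 (List.cons.inj h1).1.symm
      rcases hc : c s with _ | k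
      · have hrev : (place p c ++ [a] ++ List.replicate 0 0).reverse = a :: (place p c).reverse := by
          simp
        rw [hrev, insBefore, pos_reverse, hposp]
        rcases Nat.lt_or_ge p.length a with h | h
        · have hxa : x < a := by omega
          rw [if_neg (by omega)]
          obtain ⟨c', h1, h2⟩ := ihN (a :: 0 :: x :: t)
            (by rw [hsuba]; simpa using h) (hheada h _)
          refine ⟨Function.update c' s 1, ?_, ?_⟩
          · rw [place_update]
            simpa using h1
          · rw [evolve_succ_green (χ := zeroGreen v) (by rw [hzg]; simpa using hxa),
              evolve_succ_red (k := 0) (by rw [hfg, if_neg (by omega)]) (by simp), evolve_update, h2,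
              hc]
        · rw [if_pos h] at hfg
          rcases Nat.lt_or_gt_of_ne hax with hax | hax
          · have hred : decide (x < a) = false := by simpa using hax.le
            rw [hred] at hzg hfg
            rw [if_neg (by omega)]
            -- As `a < x`, the entering zero stops behind `a`, where the `e` zeros from the left
            -- join it.
            obtain ⟨c', e, h1, h2⟩ := ihA a (0 :: x :: t) (x :: q') rfl h
            refine ⟨Function.update c' s (e + 1), ?_, ?_⟩
            · rw [place_update, List.replicate_succ']
              rw [ins_iterate_cons] at h1
              · simpa using h1
              · intro x' t' h3 h4
                obtain ⟨rfl, -⟩ := List.cons.inj h3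
                omega
            · rw [evolve_succ_red_zero hzg hc, evolve_succ_red hfg (Function.update_self ..),
                evolve_update, h2]
          · have hgreen : decide (x < a) = true := by simpa using hax
            rw [hgreen] at hzg hfg
            rw [if_pos ⟨hax, h⟩]
            obtain ⟨c', h1, h2⟩ := ihB a (x :: t) (x :: q') rfl h
            refine ⟨Function.update c' s 0, ?_, ?_⟩
            · rw [place_update]
              simpa using h1
            · rw [evolve_succ_green hzg, evolve_succ_green hfg, Function.update_self, evolve_update,
                h2, hc, push_add_single]
      -- An entering zero is stopped by the zeros of the slot and becomes its rightmost one. If `a`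
      -- is subexcedent, the leftmost one goes on in its place.
      · have hrev : insBefore (place p c ++ [a] ++ List.replicate (k + 1) 0).reverse x t =
            place p c ++ [a] ++ List.replicate (k + 1) 0 ++ 0 :: x :: t := by
          rw [List.replicate_succ', ← List.append_assoc, List.reverse_append, List.reverse_singleton,
            List.singleton_append, insBefore, if_neg (by omega)]
          simp
        rw [hrev]
        rcases Nat.lt_or_ge p.length a with h | h
        · have hxa : x < a := by omega
          rw [← hcnt, phiTo_zeros_stay (u := place p c ++ [a]) (hlast.resolve_left (by omega))
            (by rwa [hpos]), hcnt]
          obtain ⟨c', h1, h2⟩ := ihN (a :: (List.replicate (k + 1) 0 ++ 0 :: x :: t))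
            (by rw [hsuba]; simpa using h) (hheada h _)
          refine ⟨Function.update c' s (k + 1 + 1), ?_, ?_⟩
          · rw [place_update, List.replicate_succ' (n := k + 1)]
            simpa using h1
          · rw [evolve_succ_green (χ := zeroGreen v) (by rw [hzg]; simpa using hxa),
              evolve_succ_red (k := k + 1) (by rw [hfg, if_neg (by omega)]) (by simp),
              evolve_update, h2, hc]
        · rw [if_pos h] at hfg
          rw [leftStay h _ k hz]
          obtain ⟨c', h1, h2⟩ := ihB a (List.replicate k 0 ++ 0 :: x :: t) (x :: q') rfl h
          refine ⟨Function.update c' s (k + 1), ?_, ?_⟩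
          · rw [h1, place_update, List.replicate_succ']
            simp
          · rcases hd : decide (x < a)
            · rw [hd] at hzg hfg
              rw [evolve_succ_red hzg hc, evolve_succ_red hfg (Function.update_self ..),
                evolve_update, h2, push_add_single]
            · rw [hd] at hzg hfg
              rw [evolve_succ_green hzg, evolve_succ_green hfg, Function.update_self, evolve_update,
                h2, hc, push_add_single]

/-- `Φ` turns the colours with respect to zeros into those with respect to fixed points. -/
theorem exists_Phi_place {v : List ℕ} (hv : ∀ x ∈ v, x ≠ 0) (hnd : v.Nodup) (c : ℕ → ℕ) :
    ∃ c', Phi (place v c) = place v c' ∧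
      evolve (zeroGreen v) c (v.length + 1) = evolve (fixGreen v) c' (v.length + 1) := by
  obtain ⟨c', h1, h2⟩ := (exists_phiTo_place hv hnd c v [] (by simp)).1 [] (by simp [sub])
    (by rintro ⟨x, t, h, -⟩; simp at h)
  exact ⟨c', by simpa [Phi_eq_phiTo] using h1, h2⟩

/-! ### `Ψ` in terms of slot contents -/

/-- The number of green slots `≥ j` of `σ`. -/
def greenFrom (σ : List ℕ) (j : ℕ) : ℕ :=
  (List.range' j (σ.length + 1 - j)).countP (isGreen σ)

theorem greenFrom_of_le {σ : List ℕ} {j : ℕ} (hj : j ≤ σ.length) :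
    greenFrom σ j = greenFrom σ (j + 1) + if isGreen σ j then 1 else 0 := by
  unfold greenFrom
  rw [show σ.length + 1 - j = (σ.length + 1 - (j + 1)) + 1 by omega, List.range'_succ,
    List.countP_cons]

theorem slotValue_green {σ : List ℕ} {j : ℕ} (h : isGreen σ j = true) :
    slotValue σ j = greenFrom σ (j + 1) := by
  rw [slotValue, if_pos h, greenFrom, Nat.add_sub_add_right]

/-- The value of a red slot is the number of all green slots plus that of the red slots before `j`.
The slots before `j`, green and red, number `j`, which leaves `j` plus the green ones after it. -/
theorem slotValue_red {σ : List ℕ} {j : ℕ} (hj : j ≤ σ.length) (h : isGreen σ j = false)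
    (hcol : ∀ i ≤ σ.length, isGreen σ i = false → isRed σ i = true) :
    slotValue σ j = greenFrom σ (j + 1) + j := by
  rw [slotValue, h, if_neg (by simp)]
  have h1 : List.range (σ.length + 1) =
      List.range j ++ j :: List.range' (j + 1) (σ.length + 1 - (j + 1)) := by
    rw [List.range_eq_range', List.range_eq_range', ← List.range'_succ]
    have := List.range'_append_1 (s := 0) (m := j) (n := σ.length + 1 - (j + 1) + 1)
    rw [zero_add] at this
    rw [this]
    congr 1
    omega
  have h2 : ∀ k ≤ j, (List.range k).countP (isGreen σ) + (List.range k).countP (isRed σ) = k := by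
    intro k hk
    induction k with
    | zero => rfl
    | succ k ih =>
      have := ih (by omega)
      rw [List.range_succ, List.countP_append, List.countP_append, List.countP_singleton,
        List.countP_singleton]
      have h3 : isRed σ k = !isGreen σ k := by
        cases h4 : isGreen σ k
        · exact hcol k (by omega) h4
        · simp only [isGreen, decide_eq_true_eq] at h4
          simp [isRed, h4]
      rw [h3]
      cases isGreen σ k <;> simp <;> omega
  rw [h1, List.countP_append, List.countP_cons, h, greenFrom]
  have := h2 j le_rfl
  simp
  omega

theorem psiSeqRev_replicate_green {σ : List ℕ} {j : ℕ} (h : isGreen σ j = true) (k : ℕ)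
    (I : List ℕ) :
    psiSeqRev σ (List.replicate k j ++ I) = List.replicate k (slotValue σ j) ++ psiSeqRev σ I := by
  induction k with
  | zero => rfl
  | succ k ih => simp [List.replicate_succ, psiSeqRev, h, ih]

theorem psiSeqRev_replicate_red {σ : List ℕ} {j : ℕ} (h : isGreen σ j = false) (k : ℕ)
    {I : List ℕ} (hI : ∀ i ∈ I, i < j) :
    psiSeqRev σ (List.replicate (k + 1) j ++ I) =
      List.replicate k (slotValue σ j - j) ++ (psiSeqRev σ I).map (· + 1) ++ [slotValue σ j] := by
  have h1 : I.takeWhile (· == j) = [] := by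
    cases I with
    | nil => rfl
    | cons a I => simp [(hI a (by simp)).ne]
  have h2 : I.dropWhile (· == j) = I := by
    cases I with
    | nil => rfl
    | cons a I => simp [(hI a (by simp)).ne]
  rw [List.replicate_succ, List.cons_append, psiSeqRev, h, if_neg (by simp),
    List.takeWhile_append_of_pos (by simp), List.dropWhile_append_of_pos (by simp), h1, h2]
  simp

theorem length_psiSeqRev (σ I : List ℕ) : (psiSeqRev σ I).length = I.length := by
  induction I using psiSeqRev.induct σ with
  | case1 => simp [psiSeqRev]
  | case2 i I h ih => simp [psiSeqRev, h, ih]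
  | case3 i I h ih =>
    rw [psiSeqRev, if_neg h]
    have := congrArg List.length (List.takeWhile_append_dropWhile (p := (· == i)) (l := I))
    rw [List.length_append] at this
    simp [ih]
    omega

theorem exists_eq_replicate_append {I : List ℕ} {j : ℕ} (hI : I.Pairwise (· ≥ ·))
    (hj : ∀ i ∈ I, i < j + 1) :
    ∃ k I', I = List.replicate k j ++ I' ∧ I'.Pairwise (· ≥ ·) ∧ ∀ i ∈ I', i < j := by
  induction I with
  | nil => exact ⟨0, [], rfl, by simp, by simp⟩
  | cons a I ih =>
    rw [List.pairwise_cons] at hI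
    rcases Nat.lt_succ_iff_lt_or_eq.1 (hj a (by simp)) with h | rfl
    · refine ⟨0, a :: I, rfl, List.pairwise_cons.2 hI, ?_⟩
      intro i hi
      rcases List.mem_cons.1 hi with rfl | hi
      · exact h
      · exact (hI.1 i hi).trans_lt h
    · obtain ⟨k, I', h1, h2, h3⟩ := ih hI.2 fun i hi => hj i (by simp [hi])
      exact ⟨k + 1, I', by simp [List.replicate_succ, h1], h2, h3⟩

/-- Green slots to the right of `j` have the smallest values, so terms `< j` yield values offset by
`greenFrom σ j`. With `t = greenFrom σ (j + 1)`, a green `j` contributes copies of `t` below the old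
values. A red `j` occurring `k + 1` times raises the old values by one and contributes `k` copies of
`t` and one `t + j`. These are the steps of `evolve`. -/
theorem count_psiSeqRev_aux {σ : List ℕ}
    (hcol : ∀ i ≤ σ.length, isGreen σ i = false → isRed σ i = true) {j : ℕ}
    (hj : j ≤ σ.length + 1) {I : List ℕ} (hI : I.Pairwise (· ≥ ·)) (hIj : ∀ i ∈ I, i < j) (x : ℕ) :
    (psiSeqRev σ I).count x =
      if x < greenFrom σ j then 0
      else evolve (isGreen σ) (fun i => I.count i) j (x - greenFrom σ j) := by
  induction j generalizing I x with
  | zero =>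
    obtain rfl : I = [] := by
      cases I with
      | nil => rfl
      | cons a I => exact absurd (hIj a (by simp)) (by omega)
    simp [psiSeqRev, evolve]
  | succ j ih =>
    obtain ⟨k, I', rfl, hI', hI'j⟩ := exists_eq_replicate_append hI hIj
    have hmem : j ∉ I' := fun h => (hI'j j h).false
    have hE : evolve (isGreen σ) (fun i => (List.replicate k j ++ I').count i) j =
        evolve (isGreen σ) (fun i => I'.count i) j := by
      refine evolve_congr (fun _ _ => rfl) fun i hi => ?_
      rw [List.count_append, List.count_replicate]
      simp; omega
    have hk : (List.replicate k j ++ I').count j = k := by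
      rw [List.count_append, List.count_replicate_self, List.count_eq_zero_of_not_mem hmem, add_zero]
    have ih' := ih (by omega) hI' hI'j
    have hg := greenFrom_of_le (σ := σ) (j := j) (by omega)
    set E := evolve (isGreen σ) (fun i => I'.count i) j with hEdef
    set t := greenFrom σ (j + 1) with ht
    cases h : isGreen σ j
    · rw [h, if_neg (by simp), add_zero] at hg
      rw [hg] at ih'
      cases k with
      | zero =>
        rw [evolve_succ_red_zero h hk, hE]
        simpa using ih' x
      | succ k =>
        have hsv := slotValue_red (by omega) h hcol
        rw [evolve_succ_red h hk, hE, psiSeqRev_replicate_red h k hI'j, hsv, Nat.add_sub_cancel,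
          List.count_append, List.count_append, List.count_replicate, List.count_singleton, ← ht]
        have hmap : ((psiSeqRev σ I').map (· + 1)).count x =
            if x < t + 1 then 0 else E (x - (t + 1)) := by
          cases x with
          | zero => rw [if_pos (by omega), List.count_eq_zero_of_not_mem (by simp)]
          | succ x =>
            rw [List.count_map_of_injective _ (· + 1) (fun a b h => by simpa using h), ih' x]
            simp
        rw [hmap]
        simp only [Pi.add_apply, Pi.single_apply, beq_iff_eq]
        rcases Nat.lt_trichotomy x t with h1 | h1 | h1
        · split_ifs <;> omega
        · subst h1
          simp only [Nat.sub_self, push_zero]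
          split_ifs <;> omega
        · obtain ⟨y, rfl⟩ : ∃ y, x = t + y + 1 := ⟨x - t - 1, by omega⟩
          rw [show t + y + 1 - t = y + 1 by omega, push_succ, show t + y + 1 - (t + 1) = y by omega]
          split_ifs <;> omega
    · rw [h, if_pos rfl] at hg
      rw [hg] at ih'
      rw [evolve_succ_green h, hE, hk, psiSeqRev_replicate_green h, slotValue_green h,
        List.count_append, List.count_replicate, ih', ← ht]
      simp only [beq_iff_eq]
      rcases Nat.lt_trichotomy x t with h1 | h1 | h1
      · rw [if_neg (by omega), if_pos (by omega), if_pos h1]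
      · subst h1
        simp
      · obtain ⟨y, rfl⟩ : ∃ y, x = t + y + 1 := ⟨x - t - 1, by omega⟩
        rw [if_neg (by omega), if_neg (by omega), if_neg (by omega),
          show t + y + 1 - t = y + 1 by omega, push_succ, show t + y + 1 - (t + 1) = y by omega,
          zero_add]

theorem count_psiSeqRev {σ : List ℕ}
    (hcol : ∀ i ≤ σ.length, isGreen σ i = false → isRed σ i = true) {I : List ℕ}
    (hI : I.Pairwise (· ≥ ·)) (hIσ : ∀ i ∈ I, i ≤ σ.length) (x : ℕ) :
    (psiSeqRev σ I).count x =
      evolve (isGreen σ) (fun i => I.count i) (σ.length + 1) x := by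
  have h := count_psiSeqRev_aux hcol le_rfl hI (fun i hi => Nat.lt_succ_of_le (hIσ i hi)) x
  have h0 : greenFrom σ (σ.length + 1) = 0 := by simp [greenFrom]
  simpa [h0] using h

/-! ### Colours of the slots of a derangement -/

theorem des_map {f : ℕ → ℕ} (hf : StrictMono f) (l : List ℕ) : des (l.map f) = des l := by
  induction l with
  | nil => rfl
  | cons a l ih =>
    cases l with
    | nil => rfl
    | cons b l =>
      simp only [List.map_cons, des, hf.lt_iff_lt] at ih ⊢
      rw [ih]

/-- The relabelling of the letters in the insertion of the fixed point `i + 1`. -/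
def bump (i x : ℕ) : ℕ := if x ≤ i then x else x + 1

theorem bump_strictMono (i : ℕ) : StrictMono (bump i) := by
  intro a b h
  unfold bump
  split_ifs <;> omega

theorem insertAt_eq (w : List ℕ) (i : ℕ) :
    insertAt w i = (w.take i).map (bump i) ++ (i + 1) :: (w.drop i).map (bump i) := rfl

theorem des_insertAt_zero {w : List ℕ} (hw : ∀ x ∈ w, x ≠ 0) : des (insertAt w 0) = des w := by
  rw [insertAt_eq]
  cases w with
  | nil => rfl
  | cons a w =>
    have ha := hw a (by simp)
    have := des_map (bump_strictMono 0) (a :: w)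
    simp only [List.map_cons] at this
    simp only [List.take_zero, List.map_nil, List.nil_append, List.drop_zero, List.map_cons, des,
      this]
    rw [if_neg, zero_add]
    unfold bump
    split_ifs <;> omega

theorem des_insertAt_length {p : List ℕ} {a : ℕ} (ha : a ≠ p.length + 1) :
    des (insertAt (p ++ [a]) (p.length + 1)) =
      des (p ++ [a]) + if a ≤ p.length then 0 else 1 := by
  rw [insertAt_eq, List.take_of_length_le (by simp), List.drop_of_length_le (by simp)]
  have h := des_map (bump_strictMono (p.length + 1)) (p ++ [a])
  rw [List.map_append, List.map_singleton] at h ⊢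
  rw [List.append_assoc, List.singleton_append, List.map_nil, des_append_cons, h, bump]
  simp only [des, add_zero]
  congr 1
  split_ifs <;> omega

/-- Relabelling is strictly increasing, so only the pair `a x` changes: it gives way to two pairs
with the new letter. The descent possibly lost stands on the left to avoid subtraction. -/
theorem des_insertAt {p : List ℕ} {a x : ℕ} {q : List ℕ} (ha : a ≠ p.length + 1) :
    des (insertAt (p ++ a :: x :: q) (p.length + 1)) + (if x < a then 1 else 0) =
      des (p ++ a :: x :: q) + (if a ≤ p.length then 0 else 1) +
        (if x ≤ p.length + 1 then 1 else 0) := by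
  have e : p ++ a :: x :: q = (p ++ [a]) ++ (x :: q) := by simp
  have h1 : (p ++ a :: x :: q).take (p.length + 1) = p ++ [a] := by
    rw [e, show p.length + 1 = (p ++ [a]).length by simp, List.take_left]
  have h2 : (p ++ a :: x :: q).drop (p.length + 1) = x :: q := by
    rw [e, show p.length + 1 = (p ++ [a]).length by simp, List.drop_left]
  rw [insertAt_eq, h1, h2]
  have h3 := des_map (bump_strictMono (p.length + 1)) (p ++ [a])
  have h4 := des_map (bump_strictMono (p.length + 1)) (x :: q)
  rw [List.map_append, List.map_singleton] at h3 ⊢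
  rw [List.map_cons] at h4 ⊢
  rw [List.append_assoc, List.singleton_append, des_append_cons, h3, des, h4, des_append_cons p]
  have h5 : (if p.length + 1 + 1 < bump (p.length + 1) a then 1 else 0) =
      if a ≤ p.length then 0 else 1 := by
    unfold bump; split_ifs <;> omega
  have h6 : (if bump (p.length + 1) x < p.length + 1 + 1 then 1 else 0) =
      if x ≤ p.length + 1 then 1 else 0 := by
    unfold bump; split_ifs <;> omega
  rw [h5, h6]
  omega

theorem fixedList_eq_nil {σ : List ℕ} (hσ : ∀ i (h : i < σ.length), σ[i] ≠ i + 1) :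
    fixedList σ = [] := by
  unfold fixedList
  rw [List.filter_eq_nil_iff]
  intro i hi
  rw [List.mem_range'_1] at hi
  obtain ⟨k, rfl⟩ : ∃ k, i = k + 1 := ⟨i - 1, by omega⟩
  rw [letter_succ (by omega), decide_eq_true_eq]
  exact_mod_cast hσ k (by omega)

theorem insertSlot_of_derangement {σ : List ℕ} (hσ : ∀ i (h : i < σ.length), σ[i] ≠ i + 1)
    {j : ℕ} (hj : j ≤ σ.length) : insertSlot σ j = insertAt σ j := by
  unfold insertSlot
  rw [List.range_eq_range', find?_range'_eq (i := j) (by omega) (by omega)]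
  · rfl
  · simp only [isSlot, fixedList_eq_nil hσ, List.countP_nil, zero_add, decide_true, Bool.and_true,
      decide_eq_true_eq]
    cases j with
    | zero => simp [letter]
    | succ j =>
      rw [letter_succ (by omega)]
      exact_mod_cast hσ j (by omega)
  · intro k _ hk
    simp [isSlot, fixedList_eq_nil hσ]
    omega

theorem des_insertSlot_of_derangement {σ : List ℕ} (hpos : ∀ x ∈ σ, x ≠ 0)
    (hσ : ∀ i (h : i < σ.length), σ[i] ≠ i + 1)
    {j : ℕ} (hj : j ≤ σ.length) :
    des (insertSlot σ j) = des σ + if fixGreen σ j then 0 else 1 := by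
  rw [insertSlot_of_derangement hσ hj]
  cases j with
  | zero => rw [des_insertAt_zero hpos]; simp [fixGreen]
  | succ j =>
    have e : σ = σ.take j ++ σ[j] :: σ.drop (j + 1) := by simp
    have hlen : (σ.take j).length = j := by simp; omega
    have ha := hσ j (by omega)
    generalize σ[j] = a at e ha
    generalize σ.take j = p at e hlen
    generalize σ.drop (j + 1) = q at e
    subst hlen e
    cases q with
    | nil =>
      rw [des_insertAt_length ha, fixGreen_concat]
      by_cases h : a ≤ p.length <;> simp [h]
    | cons x q =>
      have := des_insertAt (x := x) (q := q) ha
      rw [fixGreen_append_cons_cons]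
      by_cases h1 : a ≤ p.length <;> by_cases h2 : x ≤ p.length + 1 <;> by_cases h3 : x < a <;>
        simp only [h1, h2, h3, if_true, if_false, not_true_eq_false, not_false_eq_true, or_true,
          or_false, and_true, and_false, decide_true, decide_false, Bool.false_eq_true] at this ⊢ <;>
        omega

theorem isGreen_of_derangement {σ : List ℕ} (hpos : ∀ x ∈ σ, x ≠ 0)
    (hσ : ∀ i (h : i < σ.length), σ[i] ≠ i + 1)
    {j : ℕ} (hj : j ≤ σ.length) : isGreen σ j = fixGreen σ j := by
  unfold isGreen
  rw [des_insertSlot_of_derangement hpos hσ hj]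
  cases fixGreen σ j <;> simp

theorem isRed_of_derangement {σ : List ℕ} (hpos : ∀ x ∈ σ, x ≠ 0)
    (hσ : ∀ i (h : i < σ.length), σ[i] ≠ i + 1)
    {j : ℕ} (hj : j ≤ σ.length) (h : isGreen σ j = false) : isRed σ j = true := by
  rw [isGreen_of_derangement hpos hσ hj] at h
  unfold isRed
  rw [des_insertSlot_of_derangement hpos hσ hj, h]
  simp

/-! ### Words of permutations and derangements -/

theorem mem_permWords_iff {n : ℕ} {w : List ℕ} :
    w ∈ permWords n ↔ w.length = n ∧ w.Nodup ∧ ∀ x ∈ w, 1 ≤ x ∧ x ≤ n := by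
  constructor
  · rintro ⟨σ, rfl⟩
    refine ⟨by simp [oneLine], ?_, ?_⟩
    · unfold oneLine
      rw [List.nodup_ofFn]
      intro i j h
      exact σ.injective (Fin.ext (by simpa using h))
    · intro x hx
      unfold oneLine at hx
      rw [List.mem_ofFn] at hx
      obtain ⟨i, rfl⟩ := hx
      have := (σ i).isLt
      omega
  · rintro ⟨rfl, hnd, hb⟩
    have hb' : ∀ i : Fin w.length, w[i] - 1 < w.length := fun i => by
      have := hb w[i] (List.getElem_mem _)
      omega
    let f : Fin w.length → Fin w.length := fun i => ⟨w[i] - 1, hb' i⟩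
    have hf : Function.Injective f := by
      intro i j h
      have h1 : w[i] - 1 = w[j] - 1 := congrArg Fin.val h
      have h2 := hb w[i] (List.getElem_mem _)
      have h3 := hb w[j] (List.getElem_mem _)
      have h4 : w[(i : ℕ)] = w[(j : ℕ)] := by
        have h5 : w[i] = w[j] := by omega
        exact h5
      exact Fin.ext ((hnd.getElem_inj_iff).1 h4)
    refine ⟨Equiv.ofBijective f (Finite.injective_iff_bijective.1 hf), ?_⟩
    apply List.ext_getElem
    · simp [oneLine]
    · intro i h1 h2
      have := hb w[i] (List.getElem_mem _)
      simp [oneLine, f]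
      omega

theorem mem_derWords_iff {n : ℕ} {w : List ℕ} :
    w ∈ derWords n ↔ w ∈ permWords n ∧ ∀ i (h : i < w.length), w[i] ≠ i + 1 := by
  constructor
  · rintro ⟨σ, hσ, rfl⟩
    refine ⟨⟨σ, rfl⟩, fun i h => ?_⟩
    have hi : i < n := by simpa [oneLine] using h
    have := hσ ⟨i, hi⟩
    intro h1
    apply this
    apply Fin.ext
    simpa [oneLine] using h1
  · rintro ⟨⟨σ, rfl⟩, h⟩
    refine ⟨σ, fun i hi => ?_, rfl⟩
    apply h i (by simp [oneLine])
    simp [oneLine, hi]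

theorem permWords_finite (n : ℕ) : (permWords n).Finite := Set.finite_range _

theorem derWords_ne_zero {n : ℕ} {v : List ℕ} (hv : v ∈ derWords n) : ∀ x ∈ v, x ≠ 0 := by
  intro x hx
  have := (mem_permWords_iff.1 (mem_derWords_iff.1 hv).1).2.2 x hx
  omega

theorem derWords_length {n : ℕ} {v : List ℕ} (hv : v ∈ derWords n) : v.length = n :=
  (mem_permWords_iff.1 (mem_derWords_iff.1 hv).1).1

theorem derWords_nodup {n : ℕ} {v : List ℕ} (hv : v ∈ derWords n) : v.Nodup :=
  (mem_permWords_iff.1 (mem_derWords_iff.1 hv).1).2.1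

theorem insertAt_mem_permWords {n : ℕ} {w : List ℕ} (hw : w ∈ permWords n) {i : ℕ} (hi : i ≤ n) :
    insertAt w i ∈ permWords (n + 1) := by
  rw [mem_permWords_iff] at hw ⊢
  obtain ⟨h1, h2, h3⟩ := hw
  have hperm : (insertAt w i).Perm ((i + 1) :: w.map (bump i)) := by
    rw [insertAt_eq]
    refine List.perm_middle.trans ?_
    rw [← List.map_append, List.take_append_drop]
  refine ⟨by rw [hperm.length_eq]; simp [h1], ?_, ?_⟩
  · rw [hperm.nodup_iff, List.nodup_cons]
    refine ⟨?_, h2.map (bump_strictMono i).injective⟩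
    rw [List.mem_map]
    rintro ⟨x, -, hx⟩
    unfold bump at hx
    split_ifs at hx <;> omega
  · intro x hx
    rw [hperm.mem_iff, List.mem_cons, List.mem_map] at hx
    rcases hx with rfl | ⟨y, hy, rfl⟩
    · omega
    · have := h3 y hy
      unfold bump
      split_ifs <;> omega

/-! ### The map `ZDer` -/

theorem rankIn_map {f : ℕ → ℕ} (hf : StrictMono f) (y : List ℕ) (x : ℕ) :
    rankIn (y.map f) (f x) = rankIn y x := by
  unfold rankIn
  rw [List.countP_map]
  congr 1
  funext z
  simp [hf.le_iff_le]

theorem rankIn_perm {y y' : List ℕ} (h : y.Perm y') (x : ℕ) : rankIn y x = rankIn y' x :=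
  h.countP_eq _

theorem rankIn_pos {y : List ℕ} {x : ℕ} (h : x ∈ y) : 0 < rankIn y x :=
  List.countP_pos_iff.2 ⟨x, h, by simp⟩

theorem rankIn_lt {y : List ℕ} {a b : ℕ} (hab : a < b) (hb : b ∈ y) : rankIn y a < rankIn y b := by
  unfold rankIn
  induction y with
  | nil => simp at hb
  | cons c y ih =>
    have hmono : y.countP (fun z => z ≤ a) ≤ y.countP (fun z => z ≤ b) :=
      List.countP_mono_left fun z _ h => by simp at h ⊢; omega
    simp only [List.countP_cons, decide_eq_true_eq]
    rcases List.mem_cons.1 hb with rfl | hb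
    · rw [if_neg (by omega), if_pos le_rfl]; omega
    · have := ih hb
      split_ifs <;> omega

theorem rankIn_injOn {y : List ℕ} {a b : ℕ} (ha : a ∈ y) (hb : b ∈ y)
    (h : rankIn y a = rankIn y b) : a = b := by
  rcases Nat.lt_trichotomy a b with h1 | h1 | h1
  · exact absurd h (rankIn_lt h1 hb).ne
  · exact h1
  · exact absurd h (rankIn_lt h1 ha).ne'

theorem rankIn_getElem {y : List ℕ} (hy : y.Pairwise (· < ·)) {k : ℕ} (hk : k < y.length) :
    rankIn y y[k] = k + 1 := by
  induction y generalizing k with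
  | nil => simp at hk
  | cons a y ih =>
    rw [List.pairwise_cons] at hy
    unfold rankIn at ih ⊢
    cases k with
    | zero =>
      rw [List.countP_cons, List.countP_eq_zero.2]
      · simp
      · intro b hb
        have := hy.1 b hb
        simpa using this
    | succ k =>
      have hk' : k < y.length := by simpa using hk
      rw [List.countP_cons, List.getElem_cons_succ, ih hy.2 hk']
      have := hy.1 y[k] (List.getElem_mem _)
      simp [this.le]

/-- Position and letter of the non-fixed letters. -/
def movedPairs (s : ℕ) (w : List ℕ) : List (ℕ × ℕ) :=
  ((List.range' s w.length).zip w).filter fun p => p.2 ≠ p.1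

theorem movedPairs_cons (s a : ℕ) (w : List ℕ) :
    movedPairs s (a :: w) = (if a = s then [] else [(s, a)]) ++ movedPairs (s + 1) w := by
  unfold movedPairs
  rw [List.length_cons, List.range'_succ, List.zip_cons_cons, List.filter_cons]
  by_cases h : a = s <;> simp [h]

theorem movedPairs_append (s : ℕ) (w t : List ℕ) :
    movedPairs s (w ++ t) = movedPairs s w ++ movedPairs (s + w.length) t := by
  induction w generalizing s with
  | nil => simp [movedPairs]
  | cons a w ih =>
    rw [List.cons_append, movedPairs_cons, ih, movedPairs_cons, List.append_assoc, List.length_cons]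
    congr 3
    omega

theorem movedLetters_eq (w : List ℕ) : movedLetters w = (movedPairs 1 w).map Prod.snd := by
  unfold movedLetters movedPairs
  generalize (List.range' 1 w.length).zip w = l
  induction l with
  | nil => rfl
  | cons p l ih => by_cases h : p.2 = p.1 <;> simp [h] at ih ⊢ <;> exact ih

theorem mem_movedPairs {w : List ℕ} {q : ℕ × ℕ} :
    q ∈ movedPairs 1 w ↔ ∃ i, ∃ h : i < w.length, q = (i + 1, w[i]) ∧ w[i] ≠ i + 1 := by
  unfold movedPairs
  rw [List.mem_filter, List.mem_iff_getElem]
  constructor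
  · rintro ⟨⟨i, hi, rfl⟩, h⟩
    have hi' : i < w.length := by simpa using hi
    refine ⟨i, hi', by simp [add_comm], ?_⟩
    simpa [add_comm] using h
  · rintro ⟨i, hi, rfl, h⟩
    refine ⟨⟨i, by simpa using hi, by simp [add_comm]⟩, by simpa using h⟩

theorem movedPairs_fst_pairwise (w : List ℕ) :
    ((movedPairs 1 w).map Prod.fst).Pairwise (· < ·) := by
  have h : ((List.range' 1 w.length).zip w).map Prod.fst = List.range' 1 w.length :=
    List.map_fst_zip (by simp)
  refine List.Pairwise.sublist ?_ (List.pairwise_lt_range' (s := 1) (n := w.length))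
  rw [← h]
  exact List.filter_sublist.map _

/-- A permutation maps its set of non-fixed points onto itself. Hence the positions of the fixed
points determine which letters are moved. -/
theorem movedPairs_snd_perm_fst {n : ℕ} {w : List ℕ} (hw : w ∈ permWords n) :
    ((movedPairs 1 w).map Prod.snd).Perm ((movedPairs 1 w).map Prod.fst) := by
  obtain ⟨h1, h2, h3⟩ := mem_permWords_iff.1 hw
  have hnd : ((movedPairs 1 w).map Prod.snd).Nodup := by
    have h : ((List.range' 1 w.length).zip w).map Prod.snd = w := List.map_snd_zip (by simp)
    refine List.Nodup.sublist ?_ h2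
    conv_rhs => rw [← h]
    exact List.filter_sublist.map _
  have hnd' : ((movedPairs 1 w).map Prod.fst).Nodup :=
    (movedPairs_fst_pairwise w).imp fun h => h.ne
  have hsub : (movedPairs 1 w).map Prod.snd ⊆ (movedPairs 1 w).map Prod.fst := by
    intro x hx
    rw [List.mem_map] at hx
    obtain ⟨q, hq, rfl⟩ := hx
    obtain ⟨i, hi, rfl, hne⟩ := mem_movedPairs.1 hq
    have hx := h3 w[i] (List.getElem_mem _)
    obtain ⟨k, hk⟩ : ∃ k, w[i] = k + 1 := ⟨w[i] - 1, by omega⟩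
    have hkl : k < w.length := by omega
    rw [List.mem_map]
    refine ⟨(k + 1, w[k]), mem_movedPairs.2 ⟨k, hkl, rfl, ?_⟩, hk.symm⟩
    intro h
    have : i = k := (h2.getElem_inj_iff (hi := hi) (hj := hkl)).1 (by omega)
    subst this
    omega
  exact (List.subperm_of_subset hnd hsub).perm_of_length_le (by simp)

theorem length_zder (w : List ℕ) : (zder w).length = w.length := by
  simp [zder]

theorem zder_getElem {w : List ℕ} {i : ℕ} (h : i < (zder w).length) :
    (zder w)[i] = if w[i]'(by rwa [length_zder] at h) = i + 1 then 0
      else rankIn (movedLetters w) (w[i]'(by rwa [length_zder] at h)) := by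
  simp [zder, add_comm]

theorem getElem_mem_movedLetters {w : List ℕ} {i : ℕ} (h : i < w.length) (hne : w[i] ≠ i + 1) :
    w[i] ∈ movedLetters w := by
  rw [movedLetters_eq, List.mem_map]
  exact ⟨_, mem_movedPairs.2 ⟨i, h, rfl, hne⟩, rfl⟩

theorem zder_getElem_eq_zero_iff {w : List ℕ} {i : ℕ} (h : i < w.length) :
    (zder w)[i]'(by rwa [length_zder]) = 0 ↔ w[i] = i + 1 := by
  rw [zder_getElem]
  constructor
  · intro h1
    by_contra hne
    rw [if_neg hne] at h1
    exact (rankIn_pos (getElem_mem_movedLetters h hne)).ne' h1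
  · intro h1
    rw [if_pos h1]

theorem letter_zder_eq_zero_iff {w : List ℕ} {i : ℕ} (h : 1 ≤ i) (h' : i ≤ w.length) :
    letter (zder w) i = 0 ↔ letter w i = i := by
  obtain ⟨k, rfl⟩ : ∃ k, i = k + 1 := ⟨i - 1, by omega⟩
  rw [letter_succ (by rw [length_zder]; omega), letter_succ (by omega)]
  have := zder_getElem_eq_zero_iff (w := w) (i := k) (by omega)
  exact_mod_cast this

theorem fixedList_eq_zeroPos_zder (w : List ℕ) : fixedList w = zeroPos (zder w) := by
  unfold fixedList zeroPos
  rw [length_zder]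
  apply List.filter_congr
  intro i hi
  rw [List.mem_range'_1] at hi
  rw [decide_eq_decide, letter_zder_eq_zero_iff (by omega) (by omega)]

theorem slotSeq_eq (w : List ℕ) : slotSeq w = slotsOf (zeroPos (zder w)) := by
  rw [← fixedList_eq_zeroPos_zder]
  rfl

theorem filter_zder (w : List ℕ) : (zder w).filter (fun x => x ≠ 0) = der w := by
  have key : ∀ (l : List (ℕ × ℕ)) (g : ℕ → ℕ), (∀ p ∈ l, p.2 ≠ p.1 → g p.2 ≠ 0) →
      (l.map fun p => if p.2 = p.1 then 0 else g p.2).filter (fun x => x ≠ 0) =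
        (l.filterMap fun p => if p.2 = p.1 then none else some p.2).map g := by
    intro l g h
    induction l with
    | nil => rfl
    | cons p l ih =>
      have ih' := ih fun q hq => h q (by simp [hq])
      by_cases hp : p.2 = p.1
      · simpa [hp] using ih'
      · have := h p (by simp) hp
        simpa [hp, this] using ih'
  unfold zder der
  rw [key]
  · rfl
  · intro p hp hne
    apply (rankIn_pos _).ne'
    rw [movedLetters_eq, List.mem_map]
    exact ⟨p, List.mem_filter.2 ⟨hp, by simpa using hne⟩, rfl⟩

theorem place_slotSeq (w : List ℕ) : place (der w) (fun i => (slotSeq w).count i) = zder w := by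
  rw [slotSeq_eq, ← filter_zder]
  exact place_slotsOf _

/-- The moved letters and the moved positions form the same set, so a `k`-th moved letter of rank
`k` would equal its own position. -/
theorem der_mem_derWords {n : ℕ} {w : List ℕ} (hw : w ∈ permWords n) :
    der w ∈ derWords (der w).length := by
  have hperm := movedPairs_snd_perm_fst hw
  rw [← movedLetters_eq] at hperm
  rw [mem_derWords_iff, mem_permWords_iff]
  have hnd : (movedLetters w).Nodup :=
    hperm.nodup_iff.2 ((movedPairs_fst_pairwise w).imp fun h => h.ne)
  refine ⟨⟨rfl, ?_, ?_⟩, ?_⟩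
  · unfold der
    exact hnd.map_on fun a ha b hb h => rankIn_injOn ha hb h
  · intro x hx
    unfold der at hx ⊢
    rw [List.mem_map] at hx
    obtain ⟨y, hy, rfl⟩ := hx
    refine ⟨rankIn_pos hy, ?_⟩
    rw [List.length_map]
    exact List.countP_le_length
  · intro k hk h
    have hk' : k < (movedPairs 1 w).length := by simpa [der, movedLetters_eq] using hk
    have h1 : k < ((movedPairs 1 w).map Prod.fst).length := by simpa using hk'
    have h2 := rankIn_getElem (movedPairs_fst_pairwise w) h1
    have h3 : rankIn ((movedPairs 1 w).map Prod.fst) ((movedPairs 1 w)[k]).2 = k + 1 := by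
      rw [← rankIn_perm hperm, ← h]
      simp [der, movedLetters_eq]
    have h4 : ((movedPairs 1 w)[k]).2 ∈ (movedPairs 1 w).map Prod.fst := by
      rw [← hperm.mem_iff, movedLetters_eq]
      exact List.mem_map_of_mem (List.getElem_mem _)
    have h5 := rankIn_injOn h4 (List.getElem_mem h1) (h3.trans h2.symm)
    obtain ⟨i, hi, h6, h7⟩ := mem_movedPairs.1 (List.getElem_mem hk')
    rw [List.getElem_map, h6] at h5
    exact h7 h5

theorem zder_mem_sDer {n : ℕ} {w : List ℕ} (hw : w ∈ permWords n) : zder w ∈ sDer n := by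
  have hlen : (zder w).length = n := by rw [length_zder]; exact (mem_permWords_iff.1 hw).1
  have h1 := length_sub_count_zero (zder w)
  have h2 : (zder w).count 0 ≤ (zder w).length := List.count_le_length
  rw [filter_zder] at h1
  exact ⟨(der w).length, by omega, der w, der_mem_derWords hw, filter_zder w, by omega⟩

/-- The zeros give the fixed points, these give the set of moved letters, and within this set a
letter is determined by its rank. -/
theorem zder_injOn (n : ℕ) : Set.InjOn zder (permWords n) := by
  have hpos : ∀ {w w' : List ℕ}, w.length = w'.length → zder w = zder w' →
      (movedPairs 1 w).map Prod.fst ⊆ (movedPairs 1 w').map Prod.fst := by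
    intro w w' hl hz x hx
    rw [List.mem_map] at hx ⊢
    obtain ⟨q, hq, rfl⟩ := hx
    obtain ⟨i, hi, rfl, hne⟩ := mem_movedPairs.1 hq
    refine ⟨_, mem_movedPairs.2 ⟨i, by omega, rfl, ?_⟩, rfl⟩
    rw [ne_eq, ← zder_getElem_eq_zero_iff hi] at hne
    rw [ne_eq, ← zder_getElem_eq_zero_iff (by omega)]
    simpa only [hz] using hne
  intro w hw w' hw' hz
  have hl : w.length = w'.length := by rw [← length_zder w, hz, length_zder]
  have hperm := movedPairs_snd_perm_fst hw
  have hperm' := movedPairs_snd_perm_fst hw'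
  rw [← movedLetters_eq] at hperm hperm'
  have hfst : ((movedPairs 1 w).map Prod.fst).Perm ((movedPairs 1 w').map Prod.fst) :=
    (List.perm_ext_iff_of_nodup ((movedPairs_fst_pairwise w).imp fun h => h.ne)
      ((movedPairs_fst_pairwise w').imp fun h => h.ne)).2
      fun x => ⟨fun h => hpos hl hz h, fun h => hpos hl.symm hz.symm h⟩
  have hL := (hperm.trans hfst).trans hperm'.symm
  apply List.ext_getElem hl
  intro i hi hi'
  have h1 : (zder w)[i]'(by rwa [length_zder]) = (zder w')[i]'(by rwa [length_zder]) := by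
    simp only [hz]
  by_cases h : w[i] = i + 1
  · rw [(zder_getElem_eq_zero_iff hi).2 h] at h1
    rw [h, (zder_getElem_eq_zero_iff hi').1 h1.symm]
  · have h' : w'[i] ≠ i + 1 := by
      rw [ne_eq, ← zder_getElem_eq_zero_iff hi', ← h1, zder_getElem_eq_zero_iff hi]
      exact h
    rw [zder_getElem, zder_getElem, if_neg h, if_neg h', rankIn_perm hL] at h1
    exact rankIn_injOn (hL.mem_iff.1 (getElem_mem_movedLetters hi h))
      (getElem_mem_movedLetters hi' h') h1

/-! ### Insertion of fixed points -/

theorem movedPairs_map_bump_of_le {s i : ℕ} {l : List ℕ} (h : s + l.length ≤ i + 1) :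
    movedPairs s (l.map (bump i)) = (movedPairs s l).map (Prod.map id (bump i)) := by
  induction l generalizing s with
  | nil => rfl
  | cons a l ih =>
    rw [List.length_cons] at h
    have h1 : bump i a = s ↔ a = s := by unfold bump; split_ifs <;> omega
    rw [List.map_cons, movedPairs_cons, movedPairs_cons, ih (by omega), List.map_append]
    by_cases h2 : a = s
    · rw [if_pos h2, if_pos (h1.2 h2)]; rfl
    · rw [if_neg h2, if_neg (mt h1.1 h2)]; rfl

theorem movedPairs_map_bump_of_lt {s i : ℕ} {l : List ℕ} (h : i < s) :
    movedPairs (s + 1) (l.map (bump i)) =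
      (movedPairs s l).map (Prod.map (· + 1) (bump i)) := by
  induction l generalizing s with
  | nil => rfl
  | cons a l ih =>
    have h1 : bump i a = s + 1 ↔ a = s := by unfold bump; split_ifs <;> omega
    rw [List.map_cons, movedPairs_cons, movedPairs_cons, ih (by omega), List.map_append]
    by_cases h2 : a = s
    · rw [if_pos h2, if_pos (h1.2 h2)]; rfl
    · rw [if_neg h2, if_neg (mt h1.1 h2)]; rfl

theorem movedLetters_insertAt {w : List ℕ} {i : ℕ} (hi : i ≤ w.length) :
    movedLetters (insertAt w i) = (movedLetters w).map (bump i) := by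
  rw [movedLetters_eq, movedLetters_eq, insertAt_eq, movedPairs_append, movedPairs_cons,
    movedPairs_map_bump_of_le (by simp; omega)]
  have hlen : ((w.take i).map (bump i)).length = i := by simp [hi]
  rw [hlen, if_pos (by omega), List.nil_append, movedPairs_map_bump_of_lt (by omega)]
  conv_rhs => rw [← List.take_append_drop i w, movedPairs_append]
  rw [show (w.take i).length = i by simp [hi]]
  simp [Function.comp_def]

/-- The relabelling preserves the ranks of the moved letters and turns no fixed point into a moved
point or conversely. -/
theorem zder_insertAt {w : List ℕ} {i : ℕ} (hi : i ≤ w.length) :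
    zder (insertAt w i) = (zder w).take i ++ 0 :: (zder w).drop i := by
  have hlen : (insertAt w i).length = w.length + 1 := by simp [insertAt]; omega
  have hr : ∀ x, rankIn ((movedLetters w).map (bump i)) (bump i x) = rankIn (movedLetters w) x :=
    rankIn_map (bump_strictMono i) _
  apply List.ext_getElem
  · simp [length_zder, hlen]; omega
  · intro k h1 h2
    have hk : k < w.length + 1 := by rwa [length_zder, hlen] at h1
    rw [zder_getElem, movedLetters_insertAt hi]
    rcases Nat.lt_trichotomy k i with h | rfl | h
    · have e : (insertAt w i)[k] = bump i w[k] := by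
        simp only [insertAt_eq]
        rw [List.getElem_append_left (by simp; omega), List.getElem_map, List.getElem_take]
      rw [List.getElem_append_left (by simp [length_zder]; omega), List.getElem_take, zder_getElem,
        e, hr]
      have h3 : bump i w[k] = k + 1 ↔ w[k] = k + 1 := by unfold bump; split_ifs <;> omega
      simp only [h3]
    · have e : (insertAt w k)[k] = k + 1 := by
        simp only [insertAt_eq]
        rw [List.getElem_append_right (by simp)]
        simp [Nat.min_eq_left hi]
      rw [List.getElem_append_right (by simp), if_pos e]
      simp [length_zder, Nat.min_eq_left hi]
    · obtain ⟨m, rfl⟩ : ∃ m, k = i + m + 1 := ⟨k - i - 1, by omega⟩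
      have e : (insertAt w i)[i + m + 1] = bump i w[i + m] := by
        have e1 : i + m + 1 - ((w.take i).map (bump i)).length = m + 1 := by simp [hi]; omega
        simp only [insertAt_eq]
        rw [List.getElem_append_right (by simp; omega)]
        simp only [e1, List.getElem_cons_succ, List.getElem_map, List.getElem_drop]
      rw [List.getElem_append_right (by simp; omega)]
      have e2 : i + m + 1 - ((zder w).take i).length = m + 1 := by simp [hi, length_zder]; omega
      simp only [e2, List.getElem_cons_succ, List.getElem_drop]
      rw [zder_getElem, e, hr]
      have h3 : bump i w[i + m] = i + m + 1 + 1 ↔ w[i + m] = i + m + 1 := by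
        unfold bump; split_ifs <;> omega
      simp only [h3]

theorem isSlot_iff {w : List ℕ} {A B : List ℕ} (hz : zder w = A ++ B) (j : ℕ) :
    isSlot w j A.length = true ↔ (∀ A' a, A = A' ++ [a] → a ≠ 0) ∧ pos A = j := by
  have hlen : A.length ≤ w.length := by rw [← length_zder w, hz]; simp
  have hlast : letter w A.length ≠ (A.length : ℕ∞) ↔ ∀ A' a, A = A' ++ [a] → a ≠ 0 := by
    rcases List.eq_nil_or_concat A with rfl | ⟨A', a, rfl⟩
    · simp [letter]
    · rw [List.concat_eq_append] at *
      rw [ne_eq, ← letter_zder_eq_zero_iff (by simp) hlen, hz, List.append_assoc,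
        List.singleton_append, List.length_append, List.length_singleton, letter_append_cons]
      constructor
      · intro h B b hb
        obtain rfl : a = b := by simpa using (List.append_inj' hb rfl).2
        exact_mod_cast h
      · intro h
        exact_mod_cast h A' a rfl
  have hpos : pos A + A.count 0 = A.length := by
    have h1 := length_sub_count_zero A
    have h2 : A.count 0 ≤ A.length := List.count_le_length
    rw [← List.countP_eq_length_filter] at h1
    unfold pos
    omega
  rw [isSlot, Bool.and_eq_true, decide_eq_true_eq, decide_eq_true_eq, hlast,
    fixedList_eq_zeroPos_zder, hz, zeroPos_append]
  refine and_congr_right fun h => ?_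
  rw [List.countP_append, List.countP_eq_length.2, length_zeroPos, List.countP_eq_zero.2]
  · omega
  · intro x hx
    rw [List.mem_map] at hx
    obtain ⟨y, -, rfl⟩ := hx
    simp
  · intro x hx
    have hx' := hx
    unfold zeroPos at hx'
    rw [List.mem_filter, List.mem_range'_1, decide_eq_true_eq] at hx'
    rw [decide_eq_true_eq]
    -- `isSlot` counts only fixed points strictly before the boundary; none is lost because the last
    -- letter of `A` is positive.
    refine lt_of_le_of_ne (by omega) ?_
    rintro rfl
    rcases List.eq_nil_or_concat A with rfl | ⟨A', a, rfl⟩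
    · simp at hx'
    · rw [List.concat_eq_append] at *
      have h1 := hx'.2
      rw [List.length_append, List.length_singleton, letter_append_cons] at h1
      exact h A' a rfl (by exact_mod_cast h1)

/-- The search finds `A.length` first: since `A` ends in a positive letter, every shorter prefix has
fewer positive letters. -/
theorem insertSlot_eq_insertAt {w : List ℕ} {A B : List ℕ} (hz : zder w = A ++ B)
    (hA : ∀ A' a, A = A' ++ [a] → a ≠ 0) : insertSlot w (pos A) = insertAt w A.length := by
  have hlen : A.length ≤ w.length := by rw [← length_zder w, hz]; simp
  unfold insertSlot
  rw [List.range_eq_range', find?_range'_eq (i := A.length) (by omega) (by omega)]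
  · rfl
  · exact (isSlot_iff hz _).2 ⟨hA, rfl⟩
  · intro k _ hk
    rw [← Bool.not_eq_true]
    intro h
    have hz' : zder w = A.take k ++ (A.drop k ++ B) := by
      rw [← List.append_assoc, List.take_append_drop, hz]
    have hk' : (A.take k).length = k := by simp; omega
    have := isSlot_iff hz' (pos A)
    rw [hk'] at this
    have h1 := (this.1 h).2
    have h2 : pos A = pos (A.take k) + pos (A.drop k) := by
      rw [← pos_append, List.take_append_drop]
    rcases List.eq_nil_or_concat (A.drop k) with h3 | ⟨C, a, h3⟩
    · have := congrArg List.length h3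
      simp at this
      omega
    · rw [List.concat_eq_append] at h3
      have ha : a ≠ 0 := hA (A.take k ++ C) a (by
        rw [List.append_assoc, ← h3, List.take_append_drop])
      rw [h3] at h2
      simp [ha] at h2
      omega

/-- The new zero is placed at the left end of slot `j`, directly behind a positive letter or at the
beginning, as `isSlot` demands. -/
theorem exists_place_add_single {v : List ℕ} (hv : ∀ x ∈ v, x ≠ 0) (c : ℕ → ℕ) {j : ℕ}
    (hj : j ≤ v.length) :
    ∃ A B, place v c = A ++ B ∧ place v (c + Pi.single j 1) = A ++ 0 :: B ∧ pos A = j ∧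
      ∀ A' a, A = A' ++ [a] → a ≠ 0 := by
  induction v generalizing c j with
  | nil =>
    obtain rfl : j = 0 := by simpa using hj
    exact ⟨[], place [] c, rfl, by simp [place, List.replicate_succ], rfl, by simp⟩
  | cons x v ih =>
    cases j with
    | zero =>
      refine ⟨[], place (x :: v) c, rfl, ?_, rfl, by simp⟩
      simp [place, List.replicate_succ]
    | succ j =>
      have hx : x ≠ 0 := hv x (by simp)
      obtain ⟨A, B, h1, h2, h3, h4⟩ := ih (fun y hy => hv y (by simp [hy])) (fun i => c (i + 1))
        (j := j) (by simpa using hj)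
      refine ⟨List.replicate (c 0) 0 ++ x :: A, B, by simp [place, h1], ?_, ?_, ?_⟩
      · have : (fun i => (c + Pi.single (j + 1) 1 : ℕ → ℕ) (i + 1)) =
            (fun i => c (i + 1)) + Pi.single j 1 := by
          funext i
          simp [Pi.single_apply]
        rw [place, this, h2]
        simp
      · simp [hx, h3, pos_replicate_zero]
      · intro A' a h
        rcases List.eq_nil_or_concat A with rfl | ⟨C, b, rfl⟩
        · obtain rfl : x = a := by simpa using (List.append_inj' h rfl).2
          exact hx
        · rw [List.concat_eq_append, ← List.cons_append, ← List.append_assoc] at h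
          obtain rfl : b = a := by simpa using (List.append_inj' h rfl).2
          exact h4 C b List.concat_eq_append

theorem zder_of_derWords {p : ℕ} {σ : List ℕ} (hσ : σ ∈ derWords p) : zder σ = σ := by
  obtain ⟨hperm, hne⟩ := mem_derWords_iff.1 hσ
  obtain ⟨h1, h2, h3⟩ := mem_permWords_iff.1 hperm
  have hall : movedPairs 1 σ = (List.range' 1 σ.length).zip σ := by
    unfold movedPairs
    rw [List.filter_eq_self]
    intro q hq
    obtain ⟨i, hi, rfl⟩ := List.mem_iff_getElem.1 hq
    have := hne i (by simpa using hi)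
    simpa [add_comm] using this
  have hL : movedLetters σ = σ := by
    rw [movedLetters_eq, hall, List.map_snd_zip (by simp)]
  have hfst : (movedPairs 1 σ).map Prod.fst = List.range' 1 σ.length := by
    rw [hall, List.map_fst_zip (by simp)]
  have hpr := movedPairs_snd_perm_fst hperm
  rw [← movedLetters_eq, hL, hfst] at hpr
  apply List.ext_getElem (length_zder σ)
  intro i hi hi'
  rw [zder_getElem, if_neg (hne i hi'), hL, rankIn_perm hpr]
  have hb := h3 σ[i] (List.getElem_mem _)
  have hk : σ[i] - 1 < (List.range' 1 σ.length).length := by simp; omega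
  have := rankIn_getElem (List.pairwise_lt_range' (s := 1) (n := σ.length)) hk
  rw [List.getElem_range'] at this
  rw [show 1 + 1 * (σ[i] - 1) = σ[i] by omega] at this
  omega

/-- Only multiplicities matter, so `I` need not be sorted; this allows its use for the output of
`psiSeqRev`. -/
theorem insertSlots_spec {p : ℕ} {σ : List ℕ} (hσ : σ ∈ derWords p) {I : List ℕ}
    (hI : ∀ i ∈ I, i ≤ p) :
    insertSlots σ I ∈ permWords (p + I.length) ∧
      zder (insertSlots σ I) = place σ fun i => I.count i := by
  have hv := derWords_ne_zero hσ
  have hlen := derWords_length hσ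
  induction I using List.reverseRecOn with
  | nil =>
    refine ⟨(mem_derWords_iff.1 hσ).1, (zder_of_derWords hσ).trans ?_⟩
    have : ∀ l : List ℕ, place l (fun i => List.count i []) = l := by
      intro l
      induction l with
      | nil => rfl
      | cons a l ih => simpa [place] using ih
    exact (this σ).symm
  | append_singleton I j ih =>
    obtain ⟨ih1, ih2⟩ := ih fun i hi => hI i (by simp [hi])
    obtain ⟨A, B, h1, h2, h3, h4⟩ := exists_place_add_single hv (fun i => I.count i) (j := j)
      (by rw [hlen]; exact hI j (by simp))
    have hs : insertSlots σ (I ++ [j]) = insertAt (insertSlots σ I) A.length := by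
      rw [← insertSlot_eq_insertAt (ih2.trans h1) h4, h3]
      simp [insertSlots]
    have hl : (insertSlots σ I).length = p + I.length := (mem_permWords_iff.1 ih1).1
    have hA : A.length ≤ p + I.length := by
      rw [← hl, ← length_zder (insertSlots σ I), ih2, h1]
      simp
    rw [hs]
    refine ⟨?_, ?_⟩
    · rw [List.length_append, List.length_singleton, ← add_assoc]
      exact insertAt_mem_permWords ih1 hA
    · have hc : (fun i => (I ++ [j]).count i) = (fun i => I.count i) + Pi.single j 1 := by
        funext i
        simp only [List.count_append, Pi.add_apply, List.count_singleton, Pi.single_apply,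
          beq_iff_eq, @eq_comm _ i j]
      rw [zder_insertAt (by rw [hl]; exact hA), ih2, hc, h2, h1, List.take_left, List.drop_left]

/-! ### The theorem -/

theorem length_slotsOf (P : List ℕ) : (slotsOf P).length = P.length := by
  simp [slotsOf]

theorem exists_eq_place {n : ℕ} {w : List ℕ} (hw : w ∈ sDer n) :
    ∃ m, ∃ v ∈ derWords m, ∃ I : List ℕ, m + I.length = n ∧ (∀ i ∈ I, i ≤ m) ∧
      w = place v fun i => I.count i := by
  obtain ⟨m, hm, v, hv, h1, h2⟩ := hw
  refine ⟨m, v, hv, slotsOf (zeroPos w), ?_, ?_, ?_⟩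
  · rw [length_slotsOf, length_zeroPos, h2]; omega
  · intro i hi
    rw [← derWords_length hv, ← h1]
    exact slotsOf_le w i hi
  · rw [← h1]
    exact (place_slotsOf w).symm

theorem place_mem_sDer_iff {m n : ℕ} {v : List ℕ} (hv : v ∈ derWords m) (c : ℕ → ℕ) :
    place v c ∈ sDer n ↔ m + ∑ i ∈ Finset.range (v.length + 1), c i = n := by
  have hpos := derWords_ne_zero hv
  constructor
  · rintro ⟨m', hm', v', hv', h1, h2⟩
    rw [filter_place hpos] at h1
    subst h1
    have := (derWords_length hv).symm.trans (derWords_length hv')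
    rw [count_zero_place hpos] at h2
    omega
  · intro h
    refine ⟨m, by omega, v, hv, filter_place hpos c, ?_⟩
    rw [count_zero_place hpos]
    omega

theorem slotSeq_le (τ : List ℕ) : ∀ i ∈ slotSeq τ, i ≤ (der τ).length := by
  rw [slotSeq_eq, ← filter_zder]
  exact slotsOf_le _

theorem length_der_add {n : ℕ} {τ : List ℕ} (hτ : τ ∈ permWords n) :
    (der τ).length + (slotSeq τ).length = n := by
  have h1 := length_sub_count_zero (zder τ)
  have h2 : (zder τ).count 0 ≤ (zder τ).length := List.count_le_length
  rw [filter_zder, length_zder, (mem_permWords_iff.1 hτ).1] at h1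
  rw [length_zder, (mem_permWords_iff.1 hτ).1] at h2
  rw [slotSeq_eq, length_slotsOf, length_zeroPos]
  omega

theorem insertSlots_slotSeq {n : ℕ} {τ : List ℕ} (hτ : τ ∈ permWords n) :
    insertSlots (der τ) (slotSeq τ) = τ := by
  obtain ⟨h1, h2⟩ := insertSlots_spec (der_mem_derWords hτ) (slotSeq_le τ)
  rw [place_slotSeq] at h2
  rw [length_der_add hτ] at h1
  exact zder_injOn n h1 hτ h2

theorem zder_bijOn (n : ℕ) : Set.BijOn zder (permWords n) (sDer n) := by
  refine ⟨fun w hw => zder_mem_sDer hw, zder_injOn n, fun w hw => ?_⟩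
  obtain ⟨m, v, hv, I, h1, h2, rfl⟩ := exists_eq_place hw
  obtain ⟨h3, h4⟩ := insertSlots_spec hv h2
  rw [h1] at h3
  exact ⟨_, h3, h4⟩

theorem sDer_finite (n : ℕ) : (sDer n).Finite := by
  rw [← (zder_bijOn n).image_eq]
  exact (permWords_finite n).image _

theorem bijOn_of_injOn_sDer {n : ℕ} {f : List ℕ → List ℕ} (hmaps : Set.MapsTo f (sDer n) (sDer n))
    (hinj : Set.InjOn f (sDer n)) : Set.BijOn f (sDer n) (sDer n) :=
  ⟨hmaps, hinj, (Set.eq_of_subset_of_ncard_le hmaps.image_subset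
    hinj.ncard_image.ge (sDer_finite n)).ge⟩

theorem Phi_bijOn (n : ℕ) : Set.BijOn Phi (sDer n) (sDer n) := by
  have hmaps : Set.MapsTo Phi (sDer n) (sDer n) := by
    intro w hw
    obtain ⟨m, v, hv, I, -, -, rfl⟩ := exists_eq_place hw
    rw [place_mem_sDer_iff hv] at hw
    obtain ⟨c', h1, h2⟩ :=
      exists_Phi_place (derWords_ne_zero hv) (derWords_nodup hv) fun i => I.count i
    rw [h1, place_mem_sDer_iff hv, ← sum_evolve (fixGreen v), ← h2, sum_evolve]
    exact hw
  refine bijOn_of_injOn_sDer hmaps ?_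
  intro w hw w' hw' h
  obtain ⟨m, v, hv, I, -, -, rfl⟩ := exists_eq_place hw
  obtain ⟨m', v', hv', I', -, -, rfl⟩ := exists_eq_place hw'
  obtain ⟨c, h1, h2⟩ :=
    exists_Phi_place (derWords_ne_zero hv) (derWords_nodup hv) fun i => I.count i
  obtain ⟨c', h1', h2'⟩ :=
    exists_Phi_place (derWords_ne_zero hv') (derWords_nodup hv') fun i => I'.count i
  rw [h1, h1'] at h
  -- Both words have the same positive letters. Equal contents of the images then give equal values
  -- of `evolve` for `zeroGreen`, hence equal contents of the originals.
  have hvv : v = v' := by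
    rw [← filter_place (derWords_ne_zero hv) c, h, filter_place (derWords_ne_zero hv')]
  subst hvv
  have hcc := place_injective (derWords_ne_zero hv) h
  rw [evolve_congr (ψ := fixGreen v) (d := c') (fun _ _ => rfl) fun i hi => hcc i (by omega),
    ← h2'] at h2
  exact place_congr fun i hi => evolve_injective h2 i (by omega)

theorem foataHanF_bijOn (n : ℕ) : Set.BijOn foataHanF (sDer n) (sDer n) := by
  have hmaps : Set.MapsTo foataHanF (sDer n) (sDer n) := by
    intro w hw
    obtain ⟨m, v, hv, I, -, -, rfl⟩ := exists_eq_place hw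
    rw [place_mem_sDer_iff hv] at hw
    rw [foataHanF_place (derWords_ne_zero hv), place_mem_sDer_iff hv, sum_evolve]
    exact hw
  have hinj : Set.InjOn foataHanF (sDer n) := by
    intro w hw w' hw' h
    obtain ⟨m, v, hv, I, -, -, rfl⟩ := exists_eq_place hw
    obtain ⟨m', v', hv', I', -, -, rfl⟩ := exists_eq_place hw'
    rw [foataHanF_place (derWords_ne_zero hv), foataHanF_place (derWords_ne_zero hv')] at h
    have hvv := congrArg (fun w => w.filter fun x => x ≠ 0) h
    simp only [filter_place (derWords_ne_zero hv), filter_place (derWords_ne_zero hv')] at hvv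
    subst hvv
    have hcc : evolve (zeroGreen v) (fun i => I.count i) (v.length + 1) =
        evolve (zeroGreen v) (fun i => I'.count i) (v.length + 1) := by
      funext i
      rcases Nat.lt_or_ge v.length i with hi | hi
      · rw [evolve_eq_zero _ _ hi, evolve_eq_zero _ _ hi]
      · exact place_injective (derWords_ne_zero hv) h i hi
    exact place_congr fun i hi => evolve_injective hcc i (by omega)
  exact bijOn_of_injOn_sDer hmaps hinj

/-- `ZDer Ψ τ` in terms of slot contents. -/
theorem psi_spec {n : ℕ} {τ : List ℕ} (hτ : τ ∈ permWords n) :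
    psi τ ∈ permWords n ∧
      zder (psi τ) = place (der τ)
        (evolve (fixGreen (der τ)) (fun i => (slotSeq τ).count i) ((der τ).length + 1)) := by
  have hσ := der_mem_derWords hτ
  have hpos := derWords_ne_zero hσ
  have hne := (mem_derWords_iff.1 hσ).2
  have hI := slotSeq_le τ
  have hsorted : (slotSeq τ).reverse.Pairwise (· ≥ ·) := by
    rw [List.pairwise_reverse, slotSeq_eq]
    exact slotsOf_sorted _
  have hcount := count_psiSeqRev (fun i hi h => isRed_of_derangement hpos hne hi h) hsorted
    (fun i hi => hI i (by simpa using hi))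
  -- The computed sequence names only existing slots, as `evolve` vanishes beyond the last one.
  have hJ : ∀ i ∈ psiSeqRev (der τ) (slotSeq τ).reverse, i ≤ (der τ).length := by
    intro i hi
    by_contra h
    have h1 := hcount i
    rw [evolve_eq_zero _ _ (by omega), List.count_eq_zero] at h1
    exact h1 hi
  obtain ⟨h1, h2⟩ := insertSlots_spec hσ hJ
  rw [length_psiSeqRev, List.length_reverse, length_der_add hτ] at h1
  refine ⟨h1, ?_⟩
  rw [psi, h2]
  congr 1
  funext i
  rw [hcount i]
  refine congrFun (evolve_congr (fun j hj => isGreen_of_derangement hpos hne (by omega)) ?_) i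
  intro j _
  rw [List.count_reverse]

/-- `ZDer Ψ τ = F w` if `Φ w = ZDer τ`. -/
theorem zder_psi {n : ℕ} {τ w : List ℕ} (hτ : τ ∈ permWords n) (hw : w ∈ sDer n)
    (h : Phi w = zder τ) : zder (psi τ) = foataHanF w := by
  obtain ⟨m, v, hv, I, -, -, rfl⟩ := exists_eq_place hw
  have hpos := derWords_ne_zero hv
  obtain ⟨c', h1, h2⟩ := exists_Phi_place hpos (derWords_nodup hv) fun i => I.count i
  rw [h1] at h
  have hv' : der τ = v := by rw [← filter_zder, ← h, filter_place hpos]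
  rw [(psi_spec hτ).2, foataHanF_place hpos, h2]
  rw [← place_slotSeq, hv'] at h
  have hc := place_injective hpos h
  rw [hv', evolve_congr (fun _ _ => rfl) fun i hi => (hc i (by omega)).symm]

theorem eqOn_psi (n : ℕ) :
    Set.EqOn psi
      (Function.invFunOn zder (permWords n) ∘ foataHanF ∘
        Function.invFunOn Phi (sDer n) ∘ zder)
      (permWords n) := by
  intro τ hτ
  have hz := zder_mem_sDer hτ
  have hΦ := (Phi_bijOn n).surjOn hz
  have h := zder_psi hτ (Function.invFunOn_mem hΦ) (Function.invFunOn_eq hΦ)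
  simp only [Function.comp_apply]
  rw [← h, (zder_injOn n).leftInvOn_invFunOn (psi_spec hτ).1]

theorem psi_bijOn (n : ℕ) : Set.BijOn psi (permWords n) (permWords n) := by
  have hz := (zder_bijOn n).invOn_invFunOn.symm.bijOn
    (Set.SurjOn.mapsTo_invFunOn (zder_bijOn n).surjOn) (zder_bijOn n).mapsTo
  have hΦ := (Phi_bijOn n).invOn_invFunOn.symm.bijOn
    (Set.SurjOn.mapsTo_invFunOn (Phi_bijOn n).surjOn) (Phi_bijOn n).mapsTo
  exact ((hz.comp (foataHanF_bijOn n)).comp (hΦ.comp (zder_bijOn n))).congr (eqOn_psi n).symm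

end FoataHan

open FoataHan in
theorem theorem2p3 (n : ℕ) :
    Set.BijOn zder (permWords n) (sDer n) ∧
    Set.BijOn Phi (sDer n) (sDer n) ∧
    Set.BijOn foataHanF (sDer n) (sDer n) ∧
    (∀ τ ∈ permWords n, insertSlots (der τ) (slotSeq τ) = τ) ∧
    Set.BijOn psi (permWords n) (permWords n) ∧
    Set.EqOn psi
      (Function.invFunOn zder (permWords n) ∘ foataHanF ∘
        Function.invFunOn Phi (sDer n) ∘ zder)
      (permWords n) :=
  ⟨zder_bijOn n, Phi_bijOn n, foataHanF_bijOn n, fun _ => insertSlots_slotSeq, psi_bijOn n,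
    eqOn_psi n⟩
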